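/- **Setting.** Let $[n]$ be the universe of possible nodes. A *dynamic graph* is a sequence $G_i=(V_i,E_i)$, $i\ge 0$, of simple graphs with $V_i\subseteq V_{i+1}\subseteq[n]$; $G_i$ is the graph at the beginning of round $i$. Between consecutive rounds arbitrarily many edges may be inserted or deleted and arbitrarily many nodes inserted (each with arbitrary incident edges). $\mathrm{changes}(i)$ is the number of edge insertions, edge deletions and node insertions up to round $i$; edges that arrive with an inserted node are not counted separately. **Locally fixable labelings.** An LFL $\mathcal L=(\Sigma,\Gamma,\mathcal E,\mathcal P,\mathrm{prep},\mathrm{fix})$ on $[n]$ consists of a set $\Sigma$ of input labels, a set $\Gamma\subseteq X^{n}$ of output labels $L_v=(L_{v1},\dots,L_{vn})$ ($X$ is the set of excerpts; $L_{vv}$ is the node excerpt of $v$ and $L_{vu}$, $u\ne v$, are its edge excerpts), and the items below, all of which may also depend on the input labels of the nodes involved. Neighbourhoods $N_v$ of $v$ are subsets of $[n]\setminus\{v\}$. * $\mathcal E$: for every unordered pair $\{v,u\}$ a set of $\{v,u\}$-correct tuples $(L_{vv},L_{vu},L_{uv},L_{uu})\in X^4$, all of which satisfy reciprocity $L_{vu}=L_{uv}$.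 * $\mathcal P$: for every $v$ and every $N_v$ a non-empty set of $N_v$-prepared labels in $\Gamma$. * $\mathrm{prep}$: if $L_v^{old}$ is $N_v^{old}$-prepared, then $L_v^{new}=\mathrm{prep}(v,N_v^{old},N_v^{new},L_v^{old})$ is $N_v^{new}$-prepared and $L^{new}_{vu}=L^{old}_{vu}$ for all $u\ne v$ with $u\notin N_v^{old}\oplus N_v^{new}$. Moreover, if an edge $\{v,u\}$ is inserted or deleted (i.e. $u\in N_v^{old}\oplus N_v^{new}$, with $u\in N_v\Leftrightarrow v\in N_u$ for both the old and the new neighbourhoods), then applying $\mathrm{prep}$ at $v$ and at $u$ to prepared labels gives $L^{new}_{vu}=L^{new}_{uv}$. * $\mathrm{fix}$: let $G$ be a graph on $[n]$ with neighbourhoods $N_w$ and a labeling $L$ with labels in $\Gamma$, let $N_v=\{u_1,\dots,u_d\}$, let $L_v$ be $N_v$-prepared, each $L_{u_i}$ be $N_{u_i}$-prepared and $L_{vu_i}=L_{u_iv}$ for all $i$. Let $(L'_v,\beta_1,\dots,\beta_d)=\mathrm{fix}(v,N_v,L_v,L_{u_1u_1},\dots,L_{u_du_d})$, let $L'_{u_i}$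 be $L_{u_i}$ with $L'_{u_iu_i}=\beta_i$ and $L'_{u_iv}=L'_{vu_i}$, and let $L'_w=L_w$ for all other $w$. Then (a) $L'_v$ is $N_v$-prepared and, for each $i$: (b1) $(L'_{vv},L'_{vu_i},L'_{u_iv},L'_{u_iu_i})$ is $\{v,u_i\}$-correct; (b2) $L'_{u_i}$ is $N_{u_i}$-prepared; (b3) for every $w\in N_{u_i}$ with $w\neq v$, if $(L_{u_iu_i},L_{u_iw},L_{wu_i},L_{ww})$ is $\{u_i,w\}$-correct then so is $(L'_{u_iu_i},L'_{u_iw},L'_{wu_i},L'_{ww})$. The star of $v$ is *consistent* if $L_v$ is $N_v$-prepared and the tuples of all edges at $v$ are correct; a labeling of a graph is *$\mathcal L$-legal* if all its stars are consistent. $\mathcal L$ is *bounded* with constant $c$ if input labels and excerpts can be encoded by $c(\lfloor\log_2 n\rfloor+1)$ bits. $\mathrm{prep}$ is *insertion-closed* if $\mathrm{prep}(v,N_v^{old},N_v^{new},L)=L$ whenever $N_v^{old}\subseteq N_v^{new}$. **Algorithms.** A deterministic dynamic distributed fixing algorithm runs synchronously. Every node stores a label in $\Gamma$ and further local memory of unrestricted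 size; it knows $n$, $\mathcal L$, its identifier, its own input label, its current neighbours and the round number modulo $15n$. The nodes of $G_0$ start round $0$ with a given labeling that is $\mathcal L$-legal for $G_0$; an inserted node chooses its initial label and memory from its local information. At the beginning of each round every node receives indications of the topology changes that just occurred at it and performs local computation; then it sends one message to each current neighbour, receives the messages of its neighbours and computes locally again. $\mathrm{incorrect}(i)$ is the number of rounds up to round $i$ in which, at the beginning (after the first local computation) or at the end, some star of the current graph is inconsistent. The algorithm handles the changes in $k$ *amortized rounds* if $\mathrm{incorrect}(i)/\mathrm{changes}(i)\le k$ for every $i$ with $\mathrm{changes}(i)>0$, for every dynamic graph, every input labeling and every legal initial labeling. **Theorem.** There is an absolute constant $k$, and for every $c$ there is a constant $C$, such that for every $n$ and every LFL $\mathcal L$ on $[n]$ that is bounded with constant $c$ and has an insertion-closed preparing function, there is a deterministic dynamic distributed fixing algorithm with messages of $C(\lfloor\log_2 n\rfloor+1)$ bits which handles edge insertions, edge deletions and node insertions in $k$ amortized rounds. -/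

import Mathlib

/-- The objects of type `M` can be encoded, injectively, by bit strings of length `b`. -/
def FitsInBits (M : Type) (b : ℕ) : Prop :=
  ∃ f : M → (Fin b → Bool), Function.Injective f

/-- The unit `⌊log₂ n⌋ + 1` in which `O(log n)`-bit sizes are measured (for `n ≥ 1` it is the
number of binary digits of `n`; the summand `1` only matters for `n ≤ 1`). -/
def logUnit (n : ℕ) : ℕ := Nat.log 2 n + 1

open Classical in
/-- The neighbourhood of `v` in `G`; the star centred at `v` is represented by this set. -/
noncomputable def nbhd {n : ℕ} (G : SimpleGraph (Fin n)) (v : Fin n) : Finset (Fin n) :=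
  Finset.univ.filter (fun u => G.Adj v u)

/-! ### Locally fixable labelings -/

/-- The data `(Σ, Γ, 𝓔, 𝓟, prep, fix)` of a locally fixable labeling on the universe `Fin n` of
possible nodes. A label of `v` is a vector of excerpts indexed by the nodes: the entry `v` is the
node excerpt and the entry `u ≠ v` the edge excerpt for `{v, u}`. All conditions on a node or an
edge may refer to the input labels of that node or of the two endpoints. -/
structure LFLData (n : ℕ) where
  /-- input labels -/
  Input : Type
  /-- excerpts -/
  Excerpt : Type
  /-- output labels, a set of vectors of excerpts -/
  labels : Set (Fin n → Excerpt)
  /-- `EdgeCorrect v u a b Lvv Lvu Luv Luu`: the tuple `(Lvv, Lvu, Luv, Luu)` is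
  `{v, u}`-correct, where `a` and `b` are the inputs of `v` and `u` -/
  EdgeCorrect : Fin n → Fin n → Input → Input → Excerpt → Excerpt → Excerpt → Excerpt → Prop
  /-- `Prepared v a N L`: the label `L` is `N`-prepared for the node `v` with input `a` -/
  Prepared : Fin n → Input → Finset (Fin n) → (Fin n → Excerpt) → Prop
  /-- `prep v a Nold Nnew L` -/
  prep : Fin n → Input → Finset (Fin n) → Finset (Fin n) → labels → labels
  /-- `fix v a N b L x`: `b` and `x` list the inputs and the node excerpts of the neighbours;
  the result is a new label of `v` and new node excerpts of the neighbours -/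
  fix : Fin n → Input → (N : Finset (Fin n)) → (N → Input) → labels → (N → Excerpt) →
    labels × (N → Excerpt)

namespace LFLData

variable {n : ℕ}

/-- `prep` is a preparing function: its values are prepared for the new neighbourhood, excerpts of
unaffected nodes do not change, and the two endpoints of an edge that is inserted or deleted change
their excerpts for this edge consistently. -/
structure IsPreparing (D : LFLData n) : Prop where
  prepared : ∀ (v : Fin n) (a : D.Input) (Nold Nnew : Finset (Fin n)) (L : D.labels),
    v ∉ Nold → v ∉ Nnew → D.Prepared v a Nold L.1 →
      D.Prepared v a Nnew (D.prep v a Nold Nnew L).1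
  unaffected : ∀ (v : Fin n) (a : D.Input) (Nold Nnew : Finset (Fin n)) (L : D.labels),
    v ∉ Nold → v ∉ Nnew → D.Prepared v a Nold L.1 →
      ∀ u, u ≠ v → u ∉ symmDiff Nold Nnew → (D.prep v a Nold Nnew L).1 u = L.1 u
  reciprocal : ∀ (v u : Fin n) (a b : D.Input) (Nold Nnew Mold Mnew : Finset (Fin n))
    (L K : D.labels), v ≠ u →
      v ∉ Nold → v ∉ Nnew → u ∉ Mold → u ∉ Mnew →
      (u ∈ Nold ↔ v ∈ Mold) → (u ∈ Nnew ↔ v ∈ Mnew) → u ∈ symmDiff Nold Nnew →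
      D.Prepared v a Nold L.1 → D.Prepared u b Mold K.1 →
        (D.prep v a Nold Nnew L).1 u = (D.prep u b Mold Mnew K).1 v

/-- The labels of all nodes after `v` has replaced its label by `r.1` and every `u ∈ N` has
replaced its node excerpt by the one given by `r.2` and its edge excerpt for `v` by `r.1`'s edge
excerpt for `u`. -/
def afterFix (D : LFLData n) (v : Fin n) (N : Finset (Fin n)) (r : D.labels × (N → D.Excerpt))
    (lab : Fin n → D.labels) (w : Fin n) : Fin n → D.Excerpt :=
  if w = v then r.1.1
  else if h : w ∈ N then
    Function.update (Function.update (lab w).1 w (r.2 ⟨w, h⟩)) v (r.1.1 w)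
  else (lab w).1

/-- `fix` is a fixing function. -/
def IsFixing (D : LFLData n) : Prop :=
  ∀ (G : SimpleGraph (Fin n)) (σ : Fin n → D.Input) (lab : Fin n → D.labels) (v : Fin n),
    D.Prepared v (σ v) (nbhd G v) (lab v).1 →
    (∀ u ∈ nbhd G v, D.Prepared u (σ u) (nbhd G u) (lab u).1) →
    (∀ u ∈ nbhd G v, (lab v).1 u = (lab u).1 v) →
    let new := D.afterFix v (nbhd G v)
      (D.fix v (σ v) (nbhd G v) (fun u => σ u) (lab v) (fun u => (lab u).1 u)) lab
    -- (a) preparedness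
    D.Prepared v (σ v) (nbhd G v) (new v) ∧
    ∀ u ∈ nbhd G v,
      -- (b1) edge-correctness
      D.EdgeCorrect v u (σ v) (σ u) (new v v) (new v u) (new u v) (new u u) ∧
      -- (b2) preparedness for the neighbour
      D.Prepared u (σ u) (nbhd G u) (new u) ∧
      -- (b3) edge-correctness for the neighbour
      ∀ w ∈ nbhd G u, w ≠ v →
        D.EdgeCorrect u w (σ u) (σ w)
          ((lab u).1 u) ((lab u).1 w) ((lab w).1 u) ((lab w).1 w) →
        D.EdgeCorrect u w (σ u) (σ w) (new u u) (new u w) (new w u) (new w w)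

end LFLData

/-- A locally fixable labeling (LFL) on the universe `Fin n` of possible nodes. -/
structure LFL (n : ℕ) extends LFLData n where
  /-- correct tuples belong to unordered pairs of nodes -/
  edge_symm : ∀ v u a b p q r s,
    toLFLData.EdgeCorrect v u a b p q r s → toLFLData.EdgeCorrect u v b a s r q p
  /-- the reciprocity property -/
  edge_reciprocal : ∀ v u a b p q r s, toLFLData.EdgeCorrect v u a b p q r s → q = r
  /-- prepared labels are output labels -/
  prepared_mem : ∀ v a N L, toLFLData.Prepared v a N L → L ∈ toLFLData.labels
  /-- every node can choose a prepared label for each of its possible neighbourhoods -/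
  prepared_nonempty : ∀ v a N, v ∉ N → ∃ L, toLFLData.Prepared v a N L
  isPreparing : toLFLData.IsPreparing
  isFixing : toLFLData.IsFixing

namespace LFL

variable {n : ℕ}

/-- Input labels and excerpts have at most `c · (⌊log₂ n⌋ + 1)` bits. -/
def BoundedBy (𝓛 : LFL n) (c : ℕ) : Prop :=
  FitsInBits 𝓛.Input (c * logUnit n) ∧ FitsInBits 𝓛.Excerpt (c * logUnit n)

/-- The preparing function leaves labels unchanged when the neighbourhood only grows. -/
def InsertionClosed (𝓛 : LFL n) : Prop :=
  ∀ (v : Fin n) (a : 𝓛.Input) (Nold Nnew : Finset (Fin n)) (L : 𝓛.labels),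
    v ∉ Nold → v ∉ Nnew → Nold ⊆ Nnew → 𝓛.prep v a Nold Nnew L = L

/-- The view of `v` in the labelled graph `G` is consistent: the label of `v` is prepared for its
neighbourhood and all tuples of edges at `v` are correct. -/
def StarConsistent (𝓛 : LFL n) (G : SimpleGraph (Fin n)) (σ : Fin n → 𝓛.Input)
    (lab : Fin n → 𝓛.labels) (v : Fin n) : Prop :=
  𝓛.Prepared v (σ v) (nbhd G v) (lab v).1 ∧
  ∀ u ∈ nbhd G v, 𝓛.EdgeCorrect v u (σ v) (σ u)
    ((lab v).1 v) ((lab v).1 u) ((lab u).1 v) ((lab u).1 u)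

/-- The labeling is `𝓛`-legal for the graph `G` with node set `V`. -/
def Legal (𝓛 : LFL n) (V : Finset (Fin n)) (G : SimpleGraph (Fin n)) (σ : Fin n → 𝓛.Input)
    (lab : Fin n → 𝓛.labels) : Prop :=
  ∀ v ∈ V, 𝓛.StarConsistent G σ lab v

end LFL

/-! ### Dynamic graphs -/

/-- A dynamic graph: at the beginning of round `i` the graph has node set `nodes i` and edges
`graph i`. From round to round any edges may be inserted and deleted and any nodes may be inserted
(each together with arbitrary incident edges); nodes are never deleted. -/
structure DynamicGraph (n : ℕ) where
  nodes : ℕ → Finset (Fin n)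
  graph : ℕ → SimpleGraph (Fin n)
  nodes_subset : ∀ i, nodes i ⊆ nodes (i + 1)
  mem_of_adj : ∀ i u v, (graph i).Adj u v → u ∈ nodes i

namespace DynamicGraph

variable {n : ℕ}

/-- Edges inserted or deleted at the beginning of round `i + 1`. Edges that come with a node
inserted in that round are not counted separately. -/
def edgeChanges (𝓖 : DynamicGraph n) (i : ℕ) : Set (Sym2 (Fin n)) :=
  {e | e ∈ symmDiff (𝓖.graph i).edgeSet (𝓖.graph (i + 1)).edgeSet ∧ ∀ v ∈ e, v ∈ 𝓖.nodes i}

/-- The number of topology changes up to round `i` (each edge insertion, edge deletion or node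
insertion counts as one). -/
noncomputable def changes (𝓖 : DynamicGraph n) (i : ℕ) : ℕ :=
  ∑ r ∈ Finset.range i, ((𝓖.nodes (r + 1) \ 𝓖.nodes r).card + (𝓖.edgeChanges r).ncard)

end DynamicGraph

/-! ### Distributed algorithms -/

/-- What a node is told at the beginning of a round: its identifier, its input, the round number
modulo `15 n`, its current neighbours, and indications of the changes that just occurred at it:
the neighbours to which an edge was inserted, those to which the edge was deleted, and the
neighbours that are newly inserted nodes. -/
structure LocalView (n : ℕ) (Input : Type) where
  id : Fin n
  input : Input
  clock : ℕ
  nbrs : Finset (Fin n)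
  inserted : Finset (Fin n)
  deleted : Finset (Fin n)
  joined : Finset (Fin n)

/-- The local views in round `i`. -/
noncomputable def DynamicGraph.localView {n : ℕ} (𝓖 : DynamicGraph n) {Input : Type}
    (σ : Fin n → Input) : ℕ → Fin n → LocalView n Input
  | 0, v => ⟨v, σ v, 0, nbhd (𝓖.graph 0) v, ∅, ∅, ∅⟩
  | i + 1, v =>
    { id := v
      input := σ v
      clock := (i + 1) % (15 * n)
      nbrs := nbhd (𝓖.graph (i + 1)) v
      inserted := (nbhd (𝓖.graph (i + 1)) v \ nbhd (𝓖.graph i) v) ∩ 𝓖.nodes i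
      deleted := nbhd (𝓖.graph i) v \ nbhd (𝓖.graph (i + 1)) v
      joined := nbhd (𝓖.graph (i + 1)) v \ 𝓖.nodes i }

/-- A deterministic synchronous distributed algorithm in which every node stores a label and some
further memory. -/
structure FixingAlgorithm {n : ℕ} (𝓛 : LFL n) where
  /-- local memory, besides the label -/
  Mem : Type
  /-- messages -/
  Msg : Type
  /-- memory of an initial node, given its initial label -/
  init : LocalView n 𝓛.Input → 𝓛.labels → Mem
  /-- label and memory of a node at the beginning of the round in which it is inserted -/
  join : LocalView n 𝓛.Input → 𝓛.labels × Mem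
  /-- local computation at the beginning of a round -/
  update : LocalView n 𝓛.Input → 𝓛.labels × Mem → 𝓛.labels × Mem
  /-- the message sent to a given neighbour -/
  send : LocalView n 𝓛.Input → 𝓛.labels × Mem → Fin n → Msg
  /-- local computation at the end of a round, given the messages received (`none` from nodes that
  are not neighbours) -/
  receive : LocalView n 𝓛.Input → 𝓛.labels × Mem → (Fin n → Option Msg) → 𝓛.labels × Mem

namespace FixingAlgorithm

variable {n : ℕ} {𝓛 : LFL n}

/-- From the states after the local computation at the beginning of round `i`, the states at the
end of that round: every node sends one message to each neighbour in the graph of round `i`. -/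
noncomputable def communicate (A : FixingAlgorithm 𝓛) (𝓖 : DynamicGraph n)
    (σ : Fin n → 𝓛.Input) (i : ℕ) (s : Fin n → 𝓛.labels × A.Mem) (v : Fin n) :
    𝓛.labels × A.Mem :=
  A.receive (𝓖.localView σ i v) (s v) (fun u =>
    if u ∈ nbhd (𝓖.graph i) v then some (A.send (𝓖.localView σ i u) (s u) v) else none)

/-- The states at the beginning of round `i`, after the local computation that follows the
indications and before the communication. Values at nodes that are not in the graph are
meaningless and never used. -/
noncomputable def beginState (A : FixingAlgorithm 𝓛) (𝓖 : DynamicGraph n)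
    (σ : Fin n → 𝓛.Input) (lab₀ : Fin n → 𝓛.labels) : ℕ → Fin n → 𝓛.labels × A.Mem
  | 0, v => (lab₀ v, A.init (𝓖.localView σ 0 v) (lab₀ v))
  | i + 1, v =>
    if v ∈ 𝓖.nodes i then
      A.update (𝓖.localView σ (i + 1) v) (A.communicate 𝓖 σ i (A.beginState 𝓖 σ lab₀ i) v)
    else A.join (𝓖.localView σ (i + 1) v)

/-- The states at the end of round `i`. -/
noncomputable def endState (A : FixingAlgorithm 𝓛) (𝓖 : DynamicGraph n)
    (σ : Fin n → 𝓛.Input) (lab₀ : Fin n → 𝓛.labels) (i : ℕ) : Fin n → 𝓛.labels × A.Mem :=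
  A.communicate 𝓖 σ i (A.beginState 𝓖 σ lab₀ i)

/-- In round `i`, at its beginning or at its end, some star is inconsistent. -/
def IncorrectRound (A : FixingAlgorithm 𝓛) (𝓖 : DynamicGraph n)
    (σ : Fin n → 𝓛.Input) (lab₀ : Fin n → 𝓛.labels) (i : ℕ) : Prop :=
  ¬ 𝓛.Legal (𝓖.nodes i) (𝓖.graph i) σ (fun v => (A.beginState 𝓖 σ lab₀ i v).1) ∨
  ¬ 𝓛.Legal (𝓖.nodes i) (𝓖.graph i) σ (fun v => (A.endState 𝓖 σ lab₀ i v).1)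

/-- The number of rounds up to round `i` (inclusive) in which some star is inconsistent. -/
noncomputable def incorrect (A : FixingAlgorithm 𝓛) (𝓖 : DynamicGraph n)
    (σ : Fin n → 𝓛.Input) (lab₀ : Fin n → 𝓛.labels) (i : ℕ) : ℕ :=
  {r : ℕ | r ≤ i ∧ A.IncorrectRound 𝓖 σ lab₀ r}.ncard

/-- `A` handles edge insertions, edge deletions and node insertions with amortized round
complexity `k`, from any initial graph whose nodes start with a legal labeling. -/
def HandlesInAmortizedRounds (A : FixingAlgorithm 𝓛) (k : ℕ) : Prop :=
  ∀ (𝓖 : DynamicGraph n) (σ : Fin n → 𝓛.Input) (lab₀ : Fin n → 𝓛.labels),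
    𝓛.Legal (𝓖.nodes 0) (𝓖.graph 0) σ lab₀ →
    ∀ i, 0 < 𝓖.changes i → (A.incorrect 𝓖 σ lab₀ i : ℝ) / (𝓖.changes i : ℝ) ≤ k

end FixingAlgorithm

/-! Rounds are grouped into phases of three. A node is dirty if it was inserted, or if an edge
between old nodes was inserted or deleted at it, since its last fix. Within a phase the dirty nodes
announce themselves, every node whose star is unchanged permits the smallest dirty node in its
closed neighbourhood to fix, and a dirty node with all permissions announces its fix. Such fixers
have pairwise distance at least three, so their fixes do not interfere (`Sound.exists_fix_finset`).
Everything refers to the graph at the start of the phase; `prep` absorbs the changes of the whole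
phase at the start of the next one.

The invariant at phase starts (`PhaseInvariant`) is that all labels are prepared, endpoints agree on
their edge excerpts, and each incorrect edge has a dirty endpoint. Insertion closure is what lets
the neighbours of an inserted node stay clean: their labels do not move, so a node insertion costs
one dirty node whatever its degree.

For the count, a change creates at most two dirty nodes. A phase that starts with dirty nodes and
sees no change in its rounds fixes at least the globally smallest of them. Hence bad phases plus
dirty nodes number at most three times the changes (`card_badPhases`), and three rounds per phase
give the constant 9. -/

namespace FitsInBits

/-! ### Encoding sizes and neighbourhoods. -/

theorem mono {M : Type} {a b : ℕ} (hab : a ≤ b) (h : FitsInBits M a) : FitsInBits M b := by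
  obtain ⟨f, hf⟩ := h
  refine ⟨fun x i => if hi : i.1 < a then f x ⟨i, hi⟩ else false, fun x y hxy => hf ?_⟩
  funext i
  simpa using congrFun hxy (Fin.castLE hab i)

theorem of_injective {M M' : Type} {b : ℕ} (g : M → M') (hg : Function.Injective g)
    (h : FitsInBits M' b) : FitsInBits M b := by
  obtain ⟨f, hf⟩ := h
  exact ⟨f ∘ g, hf.comp hg⟩

theorem prod {M M' : Type} {a b : ℕ} (h : FitsInBits M a) (h' : FitsInBits M' b) :
    FitsInBits (M × M') (a + b) := by
  obtain ⟨f, hf⟩ := h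
  obtain ⟨g, hg⟩ := h'
  refine ⟨fun x => Fin.append (f x.1) (g x.2), fun x y hxy => Prod.ext (hf ?_) (hg ?_)⟩
  · funext i
    simpa using congrFun hxy (Fin.castAdd b i)
  · funext i
    simpa using congrFun hxy (Fin.natAdd a i)

theorem option {M : Type} {b : ℕ} (h : FitsInBits M b) : FitsInBits (Option M) (b + 1) := by
  obtain ⟨f, hf⟩ := h
  refine ⟨fun o => Fin.cons o.isSome (o.elim (fun _ => false) f), fun x y hxy => ?_⟩
  obtain ⟨h0, h1⟩ := Fin.cons_inj.1 hxy
  cases x <;> cases y <;> simp_all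
  exact hf h1

theorem bool : FitsInBits Bool 1 := ⟨fun x _ => x, fun _ _ h => congrFun h 0⟩

end FitsInBits

theorem mem_nbhd {n : ℕ} {G : SimpleGraph (Fin n)} {v u : Fin n} : u ∈ nbhd G v ↔ G.Adj v u := by
  simp [nbhd]

theorem not_mem_nbhd_self {n : ℕ} (G : SimpleGraph (Fin n)) (v : Fin n) : v ∉ nbhd G v := by
  simp [nbhd]

theorem mem_nbhd_comm {n : ℕ} {G : SimpleGraph (Fin n)} {v u : Fin n} :
    u ∈ nbhd G v ↔ v ∈ nbhd G u := by
  rw [mem_nbhd, mem_nbhd, G.adj_comm]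

/-! ### Effect of fixing and preparing on a labeling of a static graph. -/

namespace LFL

variable {n : ℕ} (𝓛 : LFL n)

/-- The tuple of the pair `{v, u}` in the labeling `lab` is correct. -/
def PairCorrect (σ : Fin n → 𝓛.Input) (lab : Fin n → 𝓛.labels) (v u : Fin n) : Prop :=
  𝓛.EdgeCorrect v u (σ v) (σ u) ((lab v).1 v) ((lab v).1 u) ((lab u).1 v) ((lab u).1 u)

theorem PairCorrect.symm {σ : Fin n → 𝓛.Input} {lab : Fin n → 𝓛.labels} {v u : Fin n}
    (h : 𝓛.PairCorrect σ lab v u) : 𝓛.PairCorrect σ lab u v := 𝓛.edge_symm _ _ _ _ _ _ _ _ h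

/-- All labels are prepared, and the endpoints of every edge agree on its edge excerpt. -/
structure Sound (G : SimpleGraph (Fin n)) (σ : Fin n → 𝓛.Input) (lab : Fin n → 𝓛.labels) :
    Prop where
  prepared : ∀ v, 𝓛.Prepared v (σ v) (nbhd G v) (lab v).1
  reciprocal : ∀ v, ∀ u ∈ nbhd G v, (lab v).1 u = (lab u).1 v

/-- The outcome of the fixing function at `v`. -/
noncomputable def fixAt (G : SimpleGraph (Fin n)) (σ : Fin n → 𝓛.Input) (lab : Fin n → 𝓛.labels) (v : Fin n) :
    𝓛.labels × (nbhd G v → 𝓛.Excerpt) :=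
  𝓛.fix v (σ v) (nbhd G v) (fun u => σ u) (lab v) (fun u => (lab u).1 u)

theorem fixAt_congr {G : SimpleGraph (Fin n)} {σ : Fin n → 𝓛.Input} {lab lab' : Fin n → 𝓛.labels}
    {v : Fin n} (hv : lab v = lab' v) (hu : ∀ u ∈ nbhd G v, lab u = lab' u) :
    𝓛.fixAt G σ lab v = 𝓛.fixAt G σ lab' v := by
  unfold fixAt
  rw [hv]
  congr 1
  funext u
  rw [hu u u.2]

variable {𝓛}

/-- Edges at `v` become correct by (b1), edges at neighbours of `v` stay correct by (b3), and no
other label moves. Reciprocity comes from correctness at `v` and from unchanged edge excerpts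
elsewhere. -/
theorem Sound.exists_fix {G : SimpleGraph (Fin n)} {σ : Fin n → 𝓛.Input}
    {lab : Fin n → 𝓛.labels} (h : 𝓛.Sound G σ lab) (v : Fin n) :
    ∃ lab' : Fin n → 𝓛.labels,
      (∀ w, (lab' w).1 = 𝓛.afterFix v (nbhd G v) (𝓛.fixAt G σ lab v) lab w) ∧
      𝓛.Sound G σ lab' ∧
      ∀ x, ∀ y ∈ nbhd G x, (𝓛.PairCorrect σ lab x y ∨ x = v ∨ y = v) →
        𝓛.PairCorrect σ lab' x y := by
  have key := 𝓛.isFixing G σ lab v (h.prepared v) (fun u _ => h.prepared u) (h.reciprocal v)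
  change 𝓛.Prepared v (σ v) (nbhd G v) (𝓛.afterFix v (nbhd G v) (𝓛.fixAt G σ lab v) lab v) ∧ _
    at key
  set new := 𝓛.afterFix v (nbhd G v) (𝓛.fixAt G σ lab v) lab with hnew
  obtain ⟨ha, hb⟩ := key
  have hother : ∀ w, w ≠ v → w ∉ nbhd G v → new w = (lab w).1 := by
    intro w h1 h2
    simp [hnew, LFLData.afterFix, h1, h2]
  have hkeep : ∀ x y, x ≠ v → y ≠ v → y ≠ x → new x y = (lab x).1 y := by
    intro x y h1 h2 h3
    simp only [hnew, LFLData.afterFix, if_neg h1]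
    split_ifs <;> simp [h2, h3]
  have hprep : ∀ w, 𝓛.Prepared w (σ w) (nbhd G w) (new w) := by
    intro w
    by_cases h1 : w = v
    · subst h1; exact ha
    by_cases h2 : w ∈ nbhd G v
    · exact (hb w h2).2.1
    · rw [hother w h1 h2]; exact h.prepared w
  refine ⟨fun w => ⟨new w, 𝓛.prepared_mem _ _ _ _ (hprep w)⟩, fun w => rfl, ⟨hprep, ?_⟩, ?_⟩
  · intro x y hxy
    by_cases h1 : x = v
    · subst h1
      exact 𝓛.edge_reciprocal _ _ _ _ _ _ _ _ (hb y hxy).1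
    by_cases h2 : y = v
    · subst h2
      exact (𝓛.edge_reciprocal _ _ _ _ _ _ _ _ (hb x (mem_nbhd_comm.1 hxy)).1).symm
    have hne : x ≠ y := (mem_nbhd.1 hxy).ne
    change new x y = new y x
    rw [hkeep x y h1 h2 hne.symm, hkeep y x h2 h1 hne]
    exact h.reciprocal x y hxy
  · intro x y hxy hc
    change 𝓛.EdgeCorrect x y _ _ (new x x) (new x y) (new y x) (new y y)
    by_cases h1 : x = v
    · subst h1
      exact (hb y hxy).1
    by_cases h2 : y = v
    · subst h2
      exact 𝓛.edge_symm _ _ _ _ _ _ _ _ (hb x (mem_nbhd_comm.1 hxy)).1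
    have hc' : 𝓛.PairCorrect σ lab x y := by tauto
    by_cases h3 : x ∈ nbhd G v
    · exact (hb x h3).2.2 y hxy h2 hc'
    by_cases h4 : y ∈ nbhd G v
    · exact 𝓛.edge_symm _ _ _ _ _ _ _ _
        ((hb y h4).2.2 x (mem_nbhd_comm.1 hxy) h1 (hc'.symm))
    · rw [hother x h1 h3, hother y h2 h4]
      exact hc'

/-- Nodes at pairwise distance at least three can be fixed simultaneously. -/
theorem Sound.exists_fix_finset {G : SimpleGraph (Fin n)} {σ : Fin n → 𝓛.Input}
    {lab : Fin n → 𝓛.labels} (h : 𝓛.Sound G σ lab) (F : Finset (Fin n))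
    (hF : ∀ v ∈ F, ∀ w ∈ F, v ≠ w → w ∉ nbhd G v ∧ ∀ u ∈ nbhd G v, u ∉ nbhd G w) :
    ∃ lab' : Fin n → 𝓛.labels, 𝓛.Sound G σ lab' ∧
      (∀ v ∈ F, lab' v = (𝓛.fixAt G σ lab v).1) ∧
      (∀ v ∈ F, ∀ (u : Fin n) (hu : u ∈ nbhd G v), (lab' u).1 =
        Function.update (Function.update (lab u).1 u ((𝓛.fixAt G σ lab v).2 ⟨u, hu⟩)) v
          ((𝓛.fixAt G σ lab v).1.1 u)) ∧
      (∀ w, w ∉ F → (∀ v ∈ F, w ∉ nbhd G v) → lab' w = lab w) ∧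
      ∀ x, ∀ y ∈ nbhd G x, (𝓛.PairCorrect σ lab x y ∨ x ∈ F ∨ y ∈ F) →
        𝓛.PairCorrect σ lab' x y := by
  induction F using Finset.induction_on with
  | empty => exact ⟨lab, h, by simp, by simp, by simp, by simp⟩
  | insert v F hv ih =>
    obtain ⟨lab₁, hs, hfix, hnb, hother, hcor⟩ := ih fun a ha b hb =>
      hF a (Finset.mem_insert_of_mem ha) b (Finset.mem_insert_of_mem hb)
    have hvF : ∀ w ∈ F, v ∉ nbhd G w := fun w hw =>
      (hF w (Finset.mem_insert_of_mem hw) v (Finset.mem_insert_self _ _)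
        (fun e => hv (e ▸ hw))).1
    have hvF' : ∀ w ∈ F, w ∉ nbhd G v := fun w hw hm => hvF w hw (mem_nbhd_comm.1 hm)
    have hv2 : ∀ w ∈ F, ∀ u ∈ nbhd G v, u ∉ nbhd G w := fun w hw =>
      (hF v (Finset.mem_insert_self _ _) w (Finset.mem_insert_of_mem hw)
        (fun e => hv (e ▸ hw))).2
    -- The earlier fixes touch only closed neighbourhoods disjoint from that of `v`, so fixing `v`
    -- now has the same outcome as in the original labeling.
    have e1 : lab₁ v = lab v := hother v hv hvF
    have e2 : ∀ u ∈ nbhd G v, lab₁ u = lab u := fun u hu =>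
      hother u (fun huF => hvF' u huF hu) (fun w hw => hv2 w hw u hu)
    have er : 𝓛.fixAt G σ lab₁ v = 𝓛.fixAt G σ lab v := 𝓛.fixAt_congr e1 e2
    obtain ⟨lab₂, hl, hs₂, hcor₂⟩ := hs.exists_fix v
    rw [er] at hl
    have hsame : ∀ w, w ≠ v → w ∉ nbhd G v → lab₂ w = lab₁ w := by
      intro w h1 h2
      apply Subtype.ext
      rw [hl]
      simp [LFLData.afterFix, h1, h2]
    refine ⟨lab₂, hs₂, ?_, ?_, ?_, ?_⟩
    · intro w hw
      rcases Finset.mem_insert.1 hw with rfl | hw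
      · apply Subtype.ext
        rw [hl]
        simp [LFLData.afterFix]
      · rw [hsame w (fun e => hv (e ▸ hw)) (hvF' w hw)]
        exact hfix w hw
    · intro w hw u hu
      rcases Finset.mem_insert.1 hw with rfl | hw
      · have : u ≠ w := fun e => not_mem_nbhd_self G w (e ▸ hu)
        rw [hl]
        simp [LFLData.afterFix, this, hu, e2 u hu]
      · rw [hsame u (fun e => hvF w hw (e ▸ hu)) (fun hm => hv2 w hw u hm hu)]
        exact hnb w hw u hu
    · intro w hw hw'
      rw [hsame w (fun e => hw (e ▸ Finset.mem_insert_self _ _))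
        (hw' v (Finset.mem_insert_self _ _))]
      exact hother w (fun h => hw (Finset.mem_insert_of_mem h))
        (fun a ha => hw' a (Finset.mem_insert_of_mem ha))
    · intro x y hxy hc
      apply hcor₂ x y hxy
      by_cases hx : x = v
      · tauto
      by_cases hy : y = v
      · tauto
      left
      apply hcor x y hxy
      simpa [hx, hy] using hc

/-- A surviving edge keeps its excerpts at both ends, and at a new edge the two calls agree by
`reciprocal`. As `G` and `G'` are arbitrary, one call can absorb the changes of several rounds. -/
theorem Sound.prep {G G' : SimpleGraph (Fin n)} {σ : Fin n → 𝓛.Input}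
    {lab : Fin n → 𝓛.labels} (h : 𝓛.Sound G σ lab) :
    𝓛.Sound G' σ (fun v => 𝓛.prep v (σ v) (nbhd G v) (nbhd G' v) (lab v)) := by
  refine ⟨fun v => 𝓛.isPreparing.prepared v _ _ _ _ (not_mem_nbhd_self _ _)
    (not_mem_nbhd_self _ _) (h.prepared v), fun v u hu => ?_⟩
  have hne : v ≠ u := (mem_nbhd.1 hu).ne
  by_cases hold : u ∈ nbhd G v
  · change (𝓛.prep v (σ v) (nbhd G v) (nbhd G' v) (lab v)).1 u =
      (𝓛.prep u (σ u) (nbhd G u) (nbhd G' u) (lab u)).1 v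
    rw [𝓛.isPreparing.unaffected v _ _ _ _ (not_mem_nbhd_self _ _) (not_mem_nbhd_self _ _)
        (h.prepared v) u hne.symm (by simp [Finset.mem_symmDiff, hold, hu]),
      𝓛.isPreparing.unaffected u _ _ _ _ (not_mem_nbhd_self _ _) (not_mem_nbhd_self _ _)
        (h.prepared u) v hne
        (by simp [Finset.mem_symmDiff, mem_nbhd_comm.1 hold, mem_nbhd_comm.1 hu])]
    exact h.reciprocal v u hold
  · exact 𝓛.isPreparing.reciprocal v u _ _ _ _ _ _ _ _ hne (not_mem_nbhd_self _ _)
      (not_mem_nbhd_self _ _) (not_mem_nbhd_self _ _) (not_mem_nbhd_self _ _) mem_nbhd_comm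
      mem_nbhd_comm (by simp [Finset.mem_symmDiff, hold, hu]) (h.prepared v) (h.prepared u)

end LFL

/-! ### The algorithm. -/

/-- Messages: a flag (dirtiness or permission to fix), the node excerpt and the input of the
sender, and the new node and edge excerpts that result from a fix by the sender. -/
structure FixMessage {n : ℕ} (𝓛 : LFL n) where
  flag : Bool
  excerpt : 𝓛.Excerpt
  input : 𝓛.Input
  payload : Option (𝓛.Excerpt × 𝓛.Excerpt)

theorem FixMessage.fitsInBits {n : ℕ} {𝓛 : LFL n} {c : ℕ} (h : 𝓛.BoundedBy c) :
    FitsInBits (FixMessage 𝓛) ((4 * c + 2) * logUnit n) := by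
  have key := FitsInBits.bool.prod (h.2.prod (h.1.prod (h.2.prod h.2).option))
  have hL : 1 ≤ logUnit n := Nat.le_add_left _ _
  refine (key.mono ?_).of_injective
    (fun m : FixMessage 𝓛 => (m.flag, m.excerpt, m.input, m.payload)) ?_
  -- The fields take `4 * c * logUnit n + 2` bits; the two extra bits are the flag and the tag of
  -- the option.
  · nlinarith
  · rintro ⟨⟩ ⟨⟩ h
    simpa using h

/-- Local memory: the neighbourhood for which the label is prepared, whether the node waits for
being fixed, whether its star is unchanged in the current phase, the dirty nodes in the closed
neighbourhood, and a planned fix. -/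
structure FixMemory {n : ℕ} (𝓛 : LFL n) where
  base : Finset (Fin n)
  dirty : Prop
  stable : Prop
  heard : Finset (Fin n)
  plan : Option (𝓛.labels × (Fin n → 𝓛.Excerpt))

namespace LFL

variable {n : ℕ} (𝓛 : LFL n)

/-- The label chosen by an inserted node. -/
noncomputable def joinLabel (v : Fin n) (a : 𝓛.Input) : 𝓛.labels :=
  ⟨(𝓛.prepared_nonempty v a ∅ (Finset.notMem_empty v)).choose, 𝓛.prepared_mem _ _ _ _
    (𝓛.prepared_nonempty v a ∅ (Finset.notMem_empty v)).choose_spec⟩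

theorem prepared_joinLabel (v : Fin n) (a : 𝓛.Input) : 𝓛.Prepared v a ∅ (𝓛.joinLabel v a).1 :=
  (𝓛.prepared_nonempty v a ∅ (Finset.notMem_empty v)).choose_spec

/-- `L'` results from `L` by a fix that a neighbour of `v` announces in one of the messages. -/
def Announced (v : Fin n) (L : 𝓛.labels) (msgs : Fin n → Option (FixMessage 𝓛))
    (L' : 𝓛.labels) : Prop :=
  ∃ u m q, msgs u = some m ∧ m.payload = some q ∧
    L'.1 = Function.update (Function.update L.1 v q.1) u q.2

open Classical in
/-- In each phase of three rounds the dirty nodes announce themselves, then the nodes permit the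
smallest dirty node near them to fix its star, and then the nodes with all permissions announce
their fixes. Only nodes whose stars do not change during the phase take part. -/
noncomputable def phasedAlgorithm : FixingAlgorithm 𝓛 where
  Mem := FixMemory 𝓛
  Msg := FixMessage 𝓛
  init w _ := ⟨w.nbrs, False, True, ∅, none⟩
  join w := (𝓛.joinLabel w.id w.input,
    -- The chosen label is prepared for `∅`. At a phase start it is prepared for `w.nbrs` too, by
    -- insertion closure; in mid-phase the base `∅` is right, since the node had no edges when the
    -- phase began.
    if w.clock % 3 = 0 then ⟨w.nbrs, True, True, ∅, none⟩ else ⟨∅, True, False, ∅, none⟩)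
  update w s :=
    (if w.clock % 3 = 0 then 𝓛.prep w.id w.input s.2.base w.nbrs s.1 else s.1,
      { base := if w.clock % 3 = 0 then w.nbrs else s.2.base
        -- `w.joined` is ignored on purpose: an inserted node is dirty itself, and its neighbours
        -- need not be.
        dirty := s.2.dirty ∨ w.inserted.Nonempty ∨ w.deleted.Nonempty
        stable := w.clock % 3 = 0 ∨ s.2.stable ∧ w.nbrs = s.2.base
        heard := s.2.heard
        plan := s.2.plan })
  send w s u :=
    { flag := if w.clock % 3 = 0 then decide s.2.dirty
        else decide (s.2.stable ∧ ∀ x ∈ s.2.heard, u ≤ x)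
      excerpt := s.1.1 w.id
      input := w.input
      payload := if s.2.stable then s.2.plan.map (fun r => (r.2 u, r.1.1 u)) else none }
  receive w s msgs :=
    (if w.clock % 3 = 2 then
        (if s.2.stable ∧ s.2.plan.isSome then (s.2.plan.map Prod.fst).getD s.1
        else if h : ∃ L', 𝓛.Announced w.id s.1 msgs L' then h.choose else s.1)
      else s.1,
      { base := s.2.base
        dirty := s.2.dirty ∧ ¬ (w.clock % 3 = 2 ∧ s.2.stable ∧ s.2.plan.isSome)
        stable := s.2.stable
        heard := if w.clock % 3 = 0 then
            Finset.univ.filter (fun x => (x = w.id ∧ s.2.dirty) ∨ ∃ m ∈ msgs x, m.flag = true)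
          else s.2.heard
        plan := if w.clock % 3 = 1 then
            (if w.id ∈ s.2.heard ∧ s.2.stable ∧ (∀ x ∈ s.2.heard, w.id ≤ x) ∧
                ∀ u ∈ s.2.base, ∃ m ∈ msgs u, m.flag = true then
              -- Every node of the base has sent a message in this case, so the default values below
              -- are never used.
              let r := 𝓛.fix w.id w.input s.2.base
                (fun u => ((msgs u).map FixMessage.input).getD w.input) s.1
                (fun u => ((msgs u).map FixMessage.excerpt).getD (s.1.1 w.id))
              some (r.1, fun u => if h : u ∈ s.2.base then r.2 ⟨u, h⟩ else s.1.1 w.id)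
            else none)
          else s.2.plan })

end LFL

/-! ### Local views and topology changes. -/

namespace DynamicGraph

variable {n : ℕ} (𝓖 : DynamicGraph n) {Input : Type} (σ : Fin n → Input) (i : ℕ) (v : Fin n)

theorem localView_id : (𝓖.localView σ i v).id = v := by cases i <;> rfl

theorem localView_input : (𝓖.localView σ i v).input = σ v := by cases i <;> rfl

theorem localView_nbrs : (𝓖.localView σ i v).nbrs = nbhd (𝓖.graph i) v := by cases i <;> rfl

theorem localView_clock : (𝓖.localView σ i v).clock % 3 = i % 3 := by
  cases i with
  | zero => rfl
  | succ i => exact Nat.mod_mod_of_dvd _ (Dvd.intro (5 * n) (by ring))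

variable {𝓖 i v}

theorem nbhd_eq_empty (h : v ∉ 𝓖.nodes i) : nbhd (𝓖.graph i) v = ∅ := by
  refine Finset.eq_empty_of_forall_notMem fun u hu => h ?_
  exact 𝓖.mem_of_adj i v u (mem_nbhd.1 hu)

theorem mem_of_mem_nbhd {u : Fin n} (h : u ∈ nbhd (𝓖.graph i) v) : u ∈ 𝓖.nodes i :=
  𝓖.mem_of_adj i u v (mem_nbhd.1 h).symm

theorem nodes_mono : Monotone 𝓖.nodes := monotone_nat_of_le_succ 𝓖.nodes_subset

variable (𝓖) in
theorem changes_mono : Monotone 𝓖.changes :=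
  monotone_nat_of_le_succ fun i => by
    unfold changes
    rw [Finset.sum_range_succ]
    exact Nat.le_add_right _ _

/-- The exemption for edges arriving with a node is harmless here: without new nodes, every altered
edge joins old nodes and is counted. -/
theorem eq_of_changes_eq (h : 𝓖.changes (i + 1) = 𝓖.changes i) :
    𝓖.nodes (i + 1) = 𝓖.nodes i ∧ 𝓖.graph (i + 1) = 𝓖.graph i := by
  unfold changes at h
  rw [Finset.sum_range_succ] at h
  have h1 : (𝓖.nodes (i + 1) \ 𝓖.nodes i).card = 0 := by omega
  have h2 : (𝓖.edgeChanges i).ncard = 0 := by omega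
  rw [Finset.card_eq_zero, Finset.sdiff_eq_empty_iff_subset] at h1
  rw [Set.ncard_eq_zero (Set.toFinite _)] at h2
  have hn : 𝓖.nodes (i + 1) = 𝓖.nodes i := h1.antisymm (𝓖.nodes_subset i)
  refine ⟨hn, ?_⟩
  ext x y
  by_contra hxy
  have hm : s(x, y) ∈ 𝓖.edgeChanges i := by
    refine ⟨by rw [Set.mem_symmDiff, SimpleGraph.mem_edgeSet, SimpleGraph.mem_edgeSet]; tauto, ?_⟩
    have : x ∈ 𝓖.nodes i ∧ y ∈ 𝓖.nodes i := by
      by_cases ha : (𝓖.graph i).Adj x y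
      · exact ⟨𝓖.mem_of_adj _ _ _ ha, 𝓖.mem_of_adj _ _ _ ha.symm⟩
      · have hb : (𝓖.graph (i + 1)).Adj x y := by tauto
        rw [← hn]
        exact ⟨𝓖.mem_of_adj _ _ _ hb, 𝓖.mem_of_adj _ _ _ hb.symm⟩
    simpa using this
  rw [h2] at hm
  exact hm

theorem eq_of_changes_eq_of_le {j : ℕ} (hij : i ≤ j) (h : 𝓖.changes j = 𝓖.changes i) :
    𝓖.nodes j = 𝓖.nodes i ∧ 𝓖.graph j = 𝓖.graph i := by
  induction j, hij using Nat.le_induction with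
  | base => exact ⟨rfl, rfl⟩
  | succ j hij ih =>
    have h1 := changes_mono 𝓖 hij
    have h2 : 𝓖.changes j ≤ 𝓖.changes (j + 1) := changes_mono 𝓖 (Nat.le_succ j)
    obtain ⟨a, b⟩ := ih (by omega)
    obtain ⟨a', b'⟩ := eq_of_changes_eq (𝓖 := 𝓖) (i := j) (by omega)
    exact ⟨a'.trans a, b'.trans b⟩

end DynamicGraph

/-! ### Executions of the algorithm within one phase. -/

namespace LFL

section Execution

variable {n : ℕ} {𝓛 : LFL n} (𝓖 : DynamicGraph n) (σ : Fin n → 𝓛.Input)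
  (lab₀ : Fin n → 𝓛.labels)

/-- States of the phased algorithm at the beginning of round `i`. -/
noncomputable def beginAt (i : ℕ) (v : Fin n) : 𝓛.labels × FixMemory 𝓛 :=
  𝓛.phasedAlgorithm.beginState 𝓖 σ lab₀ i v

/-- States of the phased algorithm at the end of round `i`. -/
noncomputable def endAt (i : ℕ) (v : Fin n) : 𝓛.labels × FixMemory 𝓛 :=
  𝓛.phasedAlgorithm.endState 𝓖 σ lab₀ i v

open Classical in
/-- Messages received by `v` in round `i`. -/
noncomputable def received (i : ℕ) (v u : Fin n) : Option (FixMessage 𝓛) :=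
  if u ∈ nbhd (𝓖.graph i) v then
    some (𝓛.phasedAlgorithm.send (𝓖.localView σ i u) (beginAt 𝓖 σ lab₀ i u) v)
  else none

theorem beginAt_zero (v : Fin n) :
    beginAt 𝓖 σ lab₀ 0 v = (lab₀ v, ⟨nbhd (𝓖.graph 0) v, False, True, ∅, none⟩) := rfl

theorem endAt_eq (i : ℕ) (v : Fin n) : endAt 𝓖 σ lab₀ i v =
    𝓛.phasedAlgorithm.receive (𝓖.localView σ i v) (beginAt 𝓖 σ lab₀ i v)
      (received 𝓖 σ lab₀ i v) := by
  simp only [endAt, FixingAlgorithm.endState, FixingAlgorithm.communicate]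
  congr 1

variable {𝓖 σ lab₀} {i : ℕ} {v : Fin n}

theorem beginAt_succ (h : v ∈ 𝓖.nodes i) : beginAt 𝓖 σ lab₀ (i + 1) v =
    𝓛.phasedAlgorithm.update (𝓖.localView σ (i + 1) v) (endAt 𝓖 σ lab₀ i v) := by
  simp only [beginAt, FixingAlgorithm.beginState, if_pos h]
  rfl

theorem beginAt_join (h : v ∉ 𝓖.nodes i) : beginAt 𝓖 σ lab₀ (i + 1) v =
    (𝓛.joinLabel v (σ v), if (i + 1) % 3 = 0 then ⟨nbhd (𝓖.graph (i + 1)) v, True, True, ∅, none⟩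
      else ⟨∅, True, False, ∅, none⟩) := by
  simp only [beginAt, FixingAlgorithm.beginState, if_neg h, phasedAlgorithm,
    DynamicGraph.localView_id, DynamicGraph.localView_input, DynamicGraph.localView_nbrs,
    DynamicGraph.localView_clock]

theorem endAt_base : (endAt 𝓖 σ lab₀ i v).2.base = (beginAt 𝓖 σ lab₀ i v).2.base := by
  rw [endAt_eq]; rfl

theorem endAt_stable : (endAt 𝓖 σ lab₀ i v).2.stable = (beginAt 𝓖 σ lab₀ i v).2.stable := by
  rw [endAt_eq]; rfl

theorem endAt_dirty : (endAt 𝓖 σ lab₀ i v).2.dirty ↔ (beginAt 𝓖 σ lab₀ i v).2.dirty ∧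
    ¬ (i % 3 = 2 ∧ (beginAt 𝓖 σ lab₀ i v).2.stable ∧
      (beginAt 𝓖 σ lab₀ i v).2.plan.isSome) := by
  rw [endAt_eq, ← 𝓖.localView_clock σ i v]; rfl

theorem endAt_label (h : i % 3 ≠ 2) :
    (endAt 𝓖 σ lab₀ i v).1 = (beginAt 𝓖 σ lab₀ i v).1 := by
  rw [endAt_eq]
  simp [phasedAlgorithm, DynamicGraph.localView_clock, h]

theorem beginAt_succ_plan (h : v ∈ 𝓖.nodes i) :
    (beginAt 𝓖 σ lab₀ (i + 1) v).2.plan = (endAt 𝓖 σ lab₀ i v).2.plan := by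
  rw [beginAt_succ h]; rfl

theorem beginAt_succ_heard (h : v ∈ 𝓖.nodes i) :
    (beginAt 𝓖 σ lab₀ (i + 1) v).2.heard = (endAt 𝓖 σ lab₀ i v).2.heard := by
  rw [beginAt_succ h]; rfl

theorem beginAt_succ_dirty (h : v ∈ 𝓖.nodes i) : (beginAt 𝓖 σ lab₀ (i + 1) v).2.dirty ↔
    (endAt 𝓖 σ lab₀ i v).2.dirty ∨
    ((nbhd (𝓖.graph (i + 1)) v \ nbhd (𝓖.graph i) v) ∩ 𝓖.nodes i).Nonempty ∨
    (nbhd (𝓖.graph i) v \ nbhd (𝓖.graph (i + 1)) v).Nonempty := by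
  rw [beginAt_succ h]; rfl

theorem beginAt_join_dirty (h : v ∉ 𝓖.nodes i) : (beginAt 𝓖 σ lab₀ (i + 1) v).2.dirty := by
  rw [beginAt_join h]; split_ifs <;> trivial

theorem beginAt_succ_label (h : v ∈ 𝓖.nodes i) (hi : (i + 1) % 3 ≠ 0) :
    (beginAt 𝓖 σ lab₀ (i + 1) v).1 = (beginAt 𝓖 σ lab₀ i v).1 := by
  rw [beginAt_succ h, ← endAt_label (i := i) (by omega)]
  simp [phasedAlgorithm, DynamicGraph.localView_clock, hi]

theorem beginAt_succ_base (h : v ∈ 𝓖.nodes i) (hi : (i + 1) % 3 ≠ 0) :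
    (beginAt 𝓖 σ lab₀ (i + 1) v).2.base = (beginAt 𝓖 σ lab₀ i v).2.base := by
  rw [beginAt_succ h, ← endAt_base]
  simp [phasedAlgorithm, DynamicGraph.localView_clock, hi]

theorem beginAt_succ_stable (h : v ∈ 𝓖.nodes i) (hi : (i + 1) % 3 ≠ 0) :
    (beginAt 𝓖 σ lab₀ (i + 1) v).2.stable ↔ (beginAt 𝓖 σ lab₀ i v).2.stable ∧
      nbhd (𝓖.graph (i + 1)) v = (beginAt 𝓖 σ lab₀ i v).2.base := by
  rw [beginAt_succ h, ← endAt_base, ← endAt_stable]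
  simp [phasedAlgorithm, DynamicGraph.localView_clock, DynamicGraph.localView_nbrs, hi]

theorem beginAt_phase (hi : i % 3 = 0) :
    (beginAt 𝓖 σ lab₀ i v).2.base = nbhd (𝓖.graph i) v ∧ (beginAt 𝓖 σ lab₀ i v).2.stable := by
  cases i with
  | zero => exact ⟨rfl, trivial⟩
  | succ i =>
    by_cases hv : v ∈ 𝓖.nodes i
    · rw [beginAt_succ hv]
      simp [phasedAlgorithm, DynamicGraph.localView_clock, DynamicGraph.localView_nbrs, hi]
    · rw [beginAt_join hv, if_pos hi]
      exact ⟨rfl, trivial⟩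

theorem beginAt_phase_label (h : v ∈ 𝓖.nodes i) (hi : (i + 1) % 3 = 0) :
    (beginAt 𝓖 σ lab₀ (i + 1) v).1 = 𝓛.prep v (σ v) (beginAt 𝓖 σ lab₀ i v).2.base
      (nbhd (𝓖.graph (i + 1)) v) (endAt 𝓖 σ lab₀ i v).1 := by
  rw [beginAt_succ h, ← endAt_base]
  simp [phasedAlgorithm, DynamicGraph.localView_clock, DynamicGraph.localView_nbrs,
    DynamicGraph.localView_id, DynamicGraph.localView_input, hi]

variable (𝓖 σ lab₀) in
open Classical in
/-- The labels at the beginning of round `i`, extended to nodes that are not yet inserted. -/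
noncomputable def labelAt (i : ℕ) (v : Fin n) : 𝓛.labels :=
  if v ∈ 𝓖.nodes i then (beginAt 𝓖 σ lab₀ i v).1 else 𝓛.joinLabel v (σ v)

/-- Labels change only at the end of the last round and at the start of a phase. An absent node
already carries the label it would choose, so its insertion is invisible. -/
theorem labelAt_succ (hi : (i + 1) % 3 ≠ 0) :
    labelAt 𝓖 σ lab₀ (i + 1) = labelAt 𝓖 σ lab₀ i := by
  funext v
  unfold labelAt
  by_cases h : v ∈ 𝓖.nodes i
  · rw [if_pos h, if_pos (𝓖.nodes_subset i h), beginAt_succ_label h hi]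
  · rw [if_neg h, beginAt_join h, ite_self]

/-- The state of a node in the last round of a phase. -/
theorem beginAt_last (hi : i % 3 = 0) :
    (beginAt 𝓖 σ lab₀ (i + 2) v).2.base = nbhd (𝓖.graph i) v ∧
    ((beginAt 𝓖 σ lab₀ (i + 2) v).2.stable ↔ v ∈ 𝓖.nodes i ∧
      nbhd (𝓖.graph (i + 1)) v = nbhd (𝓖.graph i) v ∧
      nbhd (𝓖.graph (i + 2)) v = nbhd (𝓖.graph i) v) := by
  by_cases h1 : v ∈ 𝓖.nodes (i + 1)
  · rw [beginAt_succ_base h1 (by omega), beginAt_succ_stable h1 (by omega)]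
    by_cases h0 : v ∈ 𝓖.nodes i
    · rw [beginAt_succ_base h0 (by omega), beginAt_succ_stable h0 (by omega),
        (beginAt_phase hi).1]
      simp [(beginAt_phase (σ := σ) (lab₀ := lab₀) hi).2, h0]
    · rw [beginAt_join h0, if_neg (by omega), 𝓖.nbhd_eq_empty h0]
      simp [h0]
  · have h0 : v ∉ 𝓖.nodes i := fun h' => h1 (𝓖.nodes_subset i h')
    rw [beginAt_join h1, if_neg (by omega), 𝓖.nbhd_eq_empty h0]
    simp [h0]

theorem beginAt_mid (hi : i % 3 = 0) :
    (beginAt 𝓖 σ lab₀ (i + 1) v).2.base = nbhd (𝓖.graph i) v ∧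
    ((beginAt 𝓖 σ lab₀ (i + 1) v).2.stable ↔ v ∈ 𝓖.nodes i ∧
      nbhd (𝓖.graph (i + 1)) v = nbhd (𝓖.graph i) v) := by
  by_cases h0 : v ∈ 𝓖.nodes i
  · rw [beginAt_succ_base h0 (by omega), beginAt_succ_stable h0 (by omega),
      (beginAt_phase hi).1]
    simp [(beginAt_phase (σ := σ) (lab₀ := lab₀) hi).2, h0]
  · rw [beginAt_join h0, if_neg (by omega), 𝓖.nbhd_eq_empty h0]
    simp [h0]

theorem exists_flag_phase (hi : i % 3 = 0) {u : Fin n} :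
    (∃ m ∈ received 𝓖 σ lab₀ i v u, m.flag = true) ↔
      u ∈ nbhd (𝓖.graph i) v ∧ (beginAt 𝓖 σ lab₀ i u).2.dirty := by
  by_cases hu : u ∈ nbhd (𝓖.graph i) v
  · simp [received, hu, phasedAlgorithm, DynamicGraph.localView_clock, hi]
  · simp [received, hu]

theorem exists_flag_mid (hi : i % 3 ≠ 0) {u : Fin n} :
    (∃ m ∈ received 𝓖 σ lab₀ i v u, m.flag = true) ↔
      u ∈ nbhd (𝓖.graph i) v ∧ (beginAt 𝓖 σ lab₀ i u).2.stable ∧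
        ∀ x ∈ (beginAt 𝓖 σ lab₀ i u).2.heard, v ≤ x := by
  by_cases hu : u ∈ nbhd (𝓖.graph i) v
  · simp [received, hu, phasedAlgorithm, DynamicGraph.localView_clock, hi]
  · simp [received, hu]

open Classical in
theorem mem_heard_iff (hi : i % 3 = 0) (h : v ∈ 𝓖.nodes i) {x : Fin n} :
    x ∈ (beginAt 𝓖 σ lab₀ (i + 1) v).2.heard ↔
      (x = v ∨ x ∈ nbhd (𝓖.graph i) v) ∧ (beginAt 𝓖 σ lab₀ i x).2.dirty := by
  rw [beginAt_succ_heard h, endAt_eq]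
  simp only [phasedAlgorithm]
  rw [if_pos ((𝓖.localView_clock σ i v).trans hi)]
  refine Finset.mem_filter.trans ?_
  rw [exists_flag_phase hi, 𝓖.localView_id]
  constructor
  · rintro ⟨-, ⟨rfl, h⟩ | h⟩
    · exact ⟨Or.inl rfl, h⟩
    · exact ⟨Or.inr h.1, h.2⟩
  · rintro ⟨rfl | h, h'⟩
    · exact ⟨Finset.mem_univ _, Or.inl ⟨rfl, h'⟩⟩
    · exact ⟨Finset.mem_univ _, Or.inr ⟨h, h'⟩⟩

/-- A plan is made by a dirty node that is the smallest one in its 2-neighbourhood, if the stars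
around it are stable. -/
def MayFix (𝓖 : DynamicGraph n) (σ : Fin n → 𝓛.Input) (lab₀ : Fin n → 𝓛.labels) (i : ℕ)
    (v : Fin n) : Prop :=
  (beginAt 𝓖 σ lab₀ i v).2.dirty ∧
  ∀ u, u = v ∨ u ∈ nbhd (𝓖.graph i) v → nbhd (𝓖.graph (i + 1)) u = nbhd (𝓖.graph i) u ∧
    ∀ x, x = u ∨ x ∈ nbhd (𝓖.graph i) u → (beginAt 𝓖 σ lab₀ i x).2.dirty → v ≤ x

variable (𝓖 σ lab₀ i v) in
/-- The condition under which `v` makes a plan in round `i`. -/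
def PlanCondition : Prop :=
  v ∈ (beginAt 𝓖 σ lab₀ i v).2.heard ∧ (beginAt 𝓖 σ lab₀ i v).2.stable ∧
  (∀ x ∈ (beginAt 𝓖 σ lab₀ i v).2.heard, v ≤ x) ∧
  ∀ u ∈ (beginAt 𝓖 σ lab₀ i v).2.base, ∃ m ∈ received 𝓖 σ lab₀ i v u, m.flag = true

/-- Each node near `v` vouches for its own closed neighbourhood, whose dirty members it heard in the
first round; together the permissions express minimality within distance two. -/
theorem planCondition_iff (hi : i % 3 = 0) (h : v ∈ 𝓖.nodes i) :
    PlanCondition 𝓖 σ lab₀ (i + 1) v ↔ MayFix 𝓖 σ lab₀ i v := by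
  unfold PlanCondition MayFix
  rw [(beginAt_mid hi).1, (beginAt_mid hi).2,
    mem_heard_iff hi h]
  constructor
  · rintro ⟨⟨-, hd⟩, ⟨-, hN⟩, hx, hu⟩
    refine ⟨hd, ?_⟩
    rintro u (rfl | hu')
    · exact ⟨hN, fun x hxu hxd => hx x ((mem_heard_iff hi h).2 ⟨hxu, hxd⟩)⟩
    · have hun : u ∈ 𝓖.nodes i := 𝓖.mem_of_mem_nbhd hu'
      obtain ⟨-, hs, hh⟩ := (exists_flag_mid (by omega)).1 (hu u hu')
      exact ⟨((beginAt_mid hi).2.1 hs).2,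
        fun x hxu hxd => hh x ((mem_heard_iff hi hun).2 ⟨hxu, hxd⟩)⟩
  · rintro ⟨hd, hall⟩
    refine ⟨⟨Or.inl rfl, hd⟩, ⟨h, (hall v (Or.inl rfl)).1⟩, fun x hx => ?_, fun u hu => ?_⟩
    · obtain ⟨h1, h2⟩ := (mem_heard_iff hi h).1 hx
      exact (hall v (Or.inl rfl)).2 x h1 h2
    · have hun : u ∈ 𝓖.nodes i := 𝓖.mem_of_mem_nbhd hu
      refine (exists_flag_mid (by omega)).2 ⟨?_, ?_, fun x hx => ?_⟩
      · rw [(hall v (Or.inl rfl)).1]; exact hu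
      · exact (beginAt_mid hi).2.2 ⟨hun, (hall u (Or.inr hu)).1⟩
      · obtain ⟨h1, h2⟩ := (mem_heard_iff hi hun).1 hx
        exact (hall u (Or.inr hu)).2 x h1 h2

open Classical in
theorem endAt_plan_mid (hi : i % 3 = 1) : (endAt 𝓖 σ lab₀ i v).2.plan =
    if PlanCondition 𝓖 σ lab₀ i v then
      some ((𝓛.fix v (σ v) (beginAt 𝓖 σ lab₀ i v).2.base
          (fun u => ((received 𝓖 σ lab₀ i v u).map FixMessage.input).getD (σ v))
          (beginAt 𝓖 σ lab₀ i v).1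
          (fun u => ((received 𝓖 σ lab₀ i v u).map FixMessage.excerpt).getD
            ((beginAt 𝓖 σ lab₀ i v).1.1 v))).1,
        fun u => if h : u ∈ (beginAt 𝓖 σ lab₀ i v).2.base then
          (𝓛.fix v (σ v) (beginAt 𝓖 σ lab₀ i v).2.base
            (fun u => ((received 𝓖 σ lab₀ i v u).map FixMessage.input).getD (σ v))
            (beginAt 𝓖 σ lab₀ i v).1
            (fun u => ((received 𝓖 σ lab₀ i v u).map FixMessage.excerpt).getD
              ((beginAt 𝓖 σ lab₀ i v).1.1 v))).2 ⟨u, h⟩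
          else (beginAt 𝓖 σ lab₀ i v).1.1 v)
    else none := by
  rw [endAt_eq]
  simp only [phasedAlgorithm]
  rw [if_pos ((𝓖.localView_clock σ i v).trans hi)]
  simp only [𝓖.localView_id, 𝓖.localView_input]
  by_cases hc : PlanCondition 𝓖 σ lab₀ i v
  · rw [if_pos hc]
    exact if_pos hc
  · rw [if_neg hc]
    exact if_neg hc

theorem isSome_plan_iff (hi : i % 3 = 0) (h : v ∈ 𝓖.nodes i) :
    (beginAt 𝓖 σ lab₀ (i + 2) v).2.plan.isSome ↔ MayFix 𝓖 σ lab₀ i v := by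
  rw [beginAt_succ_plan (𝓖.nodes_subset i h), endAt_plan_mid (by omega), ← planCondition_iff hi h]
  split_ifs with hc <;> simp [hc]

theorem labelAt_of_mem (h : v ∈ 𝓖.nodes i) :
    labelAt 𝓖 σ lab₀ i v = (beginAt 𝓖 σ lab₀ i v).1 := if_pos h

theorem labelAt_of_notMem (h : v ∉ 𝓖.nodes i) :
    labelAt 𝓖 σ lab₀ i v = 𝓛.joinLabel v (σ v) := if_neg h

theorem fix_congr {a : 𝓛.Input} {N N' : Finset (Fin n)} (hN : N = N') {b : N → 𝓛.Input}
    {b' : N' → 𝓛.Input} {L L' : 𝓛.labels} (hL : L = L') {x : N → 𝓛.Excerpt} {x' : N' → 𝓛.Excerpt}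
    (hb : ∀ u (h : u ∈ N) (h' : u ∈ N'), b ⟨u, h⟩ = b' ⟨u, h'⟩)
    (hx : ∀ u (h : u ∈ N) (h' : u ∈ N'), x ⟨u, h⟩ = x' ⟨u, h'⟩) :
    (𝓛.fix v a N b L x).1 = (𝓛.fix v a N' b' L' x').1 ∧
    ∀ u (h : u ∈ N) (h' : u ∈ N'),
      (𝓛.fix v a N b L x).2 ⟨u, h⟩ = (𝓛.fix v a N' b' L' x').2 ⟨u, h'⟩ := by
  subst hN hL
  obtain rfl : b = b' := funext fun u => hb u u.2 u.2
  obtain rfl : x = x' := funext fun u => hx u u.2 u.2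
  exact ⟨rfl, fun _ _ _ => rfl⟩

/-- The plan made in round `i + 1` is the fix for the graph and labels of round `i`: the star of `v`
is still the same, and so are the labels its neighbours report. -/
theorem plan_eq (hi : i % 3 = 0) (h : v ∈ 𝓖.nodes i) (hm : MayFix 𝓖 σ lab₀ i v) :
    ∃ f, (beginAt 𝓖 σ lab₀ (i + 2) v).2.plan =
      some ((𝓛.fixAt (𝓖.graph i) σ (labelAt 𝓖 σ lab₀ i) v).1, f) ∧
      ∀ u (hu : u ∈ nbhd (𝓖.graph i) v),
        f u = (𝓛.fixAt (𝓖.graph i) σ (labelAt 𝓖 σ lab₀ i) v).2 ⟨u, hu⟩ := by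
  rw [beginAt_succ_plan (𝓖.nodes_subset i h), endAt_plan_mid (by omega),
    if_pos ((planCondition_iff hi h).2 hm)]
  have hbase := (beginAt_mid (𝓖 := 𝓖) (σ := σ) (lab₀ := lab₀) (v := v) hi).1
  have hlab : ∀ u ∈ 𝓖.nodes i, (beginAt 𝓖 σ lab₀ (i + 1) u).1 = labelAt 𝓖 σ lab₀ i u :=
    fun u hu => by rw [beginAt_succ_label hu (by omega), labelAt_of_mem hu]
  have hN := (hm.2 v (Or.inl rfl)).1
  obtain ⟨h1, h2⟩ := fix_congr (𝓛 := 𝓛) (v := v) (a := σ v) hbase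
    (b := fun u => ((received 𝓖 σ lab₀ (i + 1) v u).map FixMessage.input).getD (σ v))
    (b' := fun u => σ u) (hlab v h)
    (x := fun u => ((received 𝓖 σ lab₀ (i + 1) v u).map FixMessage.excerpt).getD
      ((beginAt 𝓖 σ lab₀ (i + 1) v).1.1 v))
    (x' := fun u => (labelAt 𝓖 σ lab₀ i u).1 u)
    (fun u _ hu => by simp [received, hN, hu, phasedAlgorithm, 𝓖.localView_input])
    (fun u _ hu => by
      simp [received, hN, hu, phasedAlgorithm, 𝓖.localView_id, hlab u (𝓖.mem_of_mem_nbhd hu)])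
  refine ⟨_, congrArg some (Prod.ext h1 rfl), fun u hu => ?_⟩
  have hu' : u ∈ (beginAt 𝓖 σ lab₀ (i + 1) v).2.base := by rw [hbase]; exact hu
  simp only [dif_pos hu']
  exact h2 u hu' hu

end Execution

end LFL

/-! ### The fixers of a phase and the invariant at phase starts. -/

namespace LFL

section Phase

variable {n : ℕ} {𝓛 : LFL n} {𝓖 : DynamicGraph n} {σ : Fin n → 𝓛.Input}
  {lab₀ : Fin n → 𝓛.labels} {i : ℕ} {v : Fin n}

variable (𝓖 σ lab₀ i) in
open Classical in
/-- The nodes that fix their stars in the phase that begins in round `i`. -/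
noncomputable def fixers : Finset (Fin n) :=
  Finset.univ.filter fun v => v ∈ 𝓖.nodes i ∧ MayFix 𝓖 σ lab₀ i v ∧
    nbhd (𝓖.graph (i + 2)) v = nbhd (𝓖.graph i) v

theorem mem_fixers : v ∈ fixers 𝓖 σ lab₀ i ↔ v ∈ 𝓖.nodes i ∧ MayFix 𝓖 σ lab₀ i v ∧
    nbhd (𝓖.graph (i + 2)) v = nbhd (𝓖.graph i) v := by
  simp [fixers]

theorem commit_iff (hi : i % 3 = 0) :
    ((beginAt 𝓖 σ lab₀ (i + 2) v).2.stable ∧ (beginAt 𝓖 σ lab₀ (i + 2) v).2.plan.isSome) ↔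
      v ∈ fixers 𝓖 σ lab₀ i := by
  rw [mem_fixers, (beginAt_last hi).2]
  constructor
  · rintro ⟨⟨h, -, h2⟩, hp⟩
    exact ⟨h, (isSome_plan_iff hi h).1 hp, h2⟩
  · rintro ⟨h, hm, h2⟩
    exact ⟨⟨h, (hm.2 v (Or.inl rfl)).1, h2⟩, (isSome_plan_iff hi h).2 hm⟩

/-- At distance at most two, each of the two dirty nodes would be minimal in a set containing the
other. -/
theorem fixers_far {w : Fin n} (hv : v ∈ fixers 𝓖 σ lab₀ i)
    (hw : w ∈ fixers 𝓖 σ lab₀ i) (hne : v ≠ w) :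
    w ∉ nbhd (𝓖.graph i) v ∧ ∀ u ∈ nbhd (𝓖.graph i) v, u ∉ nbhd (𝓖.graph i) w := by
  obtain ⟨-, hv, -⟩ := mem_fixers.1 hv
  obtain ⟨-, hw, -⟩ := mem_fixers.1 hw
  refine ⟨fun h => hne (le_antisymm ?_ ?_), fun u h h' => hne (le_antisymm ?_ ?_)⟩
  · exact (hv.2 w (Or.inr h)).2 w (Or.inl rfl) hw.1
  · exact (hw.2 v (Or.inr (mem_nbhd_comm.1 h))).2 v (Or.inl rfl) hv.1
  · exact (hv.2 u (Or.inr h)).2 w (Or.inr (mem_nbhd_comm.1 h')) hw.1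
  · exact (hw.2 u (Or.inr h')).2 v (Or.inr (mem_nbhd_comm.1 h)) hv.1

/-- Messages travel in the graph of round `i + 2`, but a fixer has the same star there as in round
`i`. So exactly its neighbours at the phase start hear it, even those whose own stars have changed
in the last round. -/
theorem announced_iff (hi : i % 3 = 0) {L L' : 𝓛.labels} :
    𝓛.Announced v L (received 𝓖 σ lab₀ (i + 2) v) L' ↔
      ∃ u ∈ fixers 𝓖 σ lab₀ i, ∃ hv : v ∈ nbhd (𝓖.graph i) u,
        L'.1 = Function.update (Function.update L.1 v
            ((𝓛.fixAt (𝓖.graph i) σ (labelAt 𝓖 σ lab₀ i) u).2 ⟨v, hv⟩)) u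
          ((𝓛.fixAt (𝓖.graph i) σ (labelAt 𝓖 σ lab₀ i) u).1.1 v) := by
  constructor
  · rintro ⟨u, m, q, hm, hq, hL⟩
    by_cases hu : u ∈ nbhd (𝓖.graph (i + 2)) v
    · rw [received, if_pos hu] at hm
      obtain rfl := Option.some_injective _ hm
      by_cases hs : (beginAt 𝓖 σ lab₀ (i + 2) u).2.stable
      · simp only [phasedAlgorithm, if_pos hs, Option.map_eq_some_iff] at hq
        obtain ⟨r, hr, rfl⟩ := hq
        have hF : u ∈ fixers 𝓖 σ lab₀ i := (commit_iff hi).1 ⟨hs, by rw [hr]; rfl⟩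
        obtain ⟨h0, hm, h2⟩ := mem_fixers.1 hF
        have hv : v ∈ nbhd (𝓖.graph i) u := by rw [← h2]; exact mem_nbhd_comm.1 hu
        obtain ⟨f, hf, hfv⟩ := plan_eq hi h0 hm
        rw [hr, Option.some_inj] at hf
        subst hf
        refine ⟨u, hF, hv, ?_⟩
        rw [hL, ← hfv v hv]
      · simp [phasedAlgorithm, if_neg hs] at hq
    · simp [received, hu] at hm
  · rintro ⟨u, hF, hv, hL⟩
    obtain ⟨h0, hm, h2⟩ := mem_fixers.1 hF
    obtain ⟨f, hf, hfv⟩ := plan_eq hi h0 hm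
    have hu : u ∈ nbhd (𝓖.graph (i + 2)) v := by rw [mem_nbhd_comm, h2]; exact hv
    refine ⟨u, _, (f v, (𝓛.fixAt (𝓖.graph i) σ (labelAt 𝓖 σ lab₀ i) u).1.1 v), if_pos hu, ?_, ?_⟩
    · simp only [phasedAlgorithm, if_pos ((commit_iff hi).2 hF).1, hf, Option.map_some]
    · rw [hL, hfv v hv]

theorem endAt_label_last (hi : i % 3 = 2) :
    ((beginAt 𝓖 σ lab₀ i v).2.stable ∧ (beginAt 𝓖 σ lab₀ i v).2.plan.isSome →
      (endAt 𝓖 σ lab₀ i v).1 =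
        ((beginAt 𝓖 σ lab₀ i v).2.plan.map Prod.fst).getD (beginAt 𝓖 σ lab₀ i v).1) ∧
    (¬ ((beginAt 𝓖 σ lab₀ i v).2.stable ∧ (beginAt 𝓖 σ lab₀ i v).2.plan.isSome) →
      (∃ L', 𝓛.Announced v (beginAt 𝓖 σ lab₀ i v).1 (received 𝓖 σ lab₀ i v) L') →
      𝓛.Announced v (beginAt 𝓖 σ lab₀ i v).1 (received 𝓖 σ lab₀ i v)
        (endAt 𝓖 σ lab₀ i v).1) ∧
    (¬ ((beginAt 𝓖 σ lab₀ i v).2.stable ∧ (beginAt 𝓖 σ lab₀ i v).2.plan.isSome) →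
      (¬ ∃ L', 𝓛.Announced v (beginAt 𝓖 σ lab₀ i v).1 (received 𝓖 σ lab₀ i v) L') →
      (endAt 𝓖 σ lab₀ i v).1 = (beginAt 𝓖 σ lab₀ i v).1) := by
  rw [endAt_eq]
  simp only [phasedAlgorithm]
  rw [if_pos ((𝓖.localView_clock σ i v).trans hi)]
  have hid := 𝓖.localView_id σ i v
  generalize (𝓖.localView σ i v).id = w at hid ⊢
  subst hid
  refine ⟨fun h => if_pos h, fun h h' => ?_, fun h h' => ?_⟩
  · rw [if_neg h, dif_pos h']
    exact h'.choose_spec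
  · rw [if_neg h, dif_neg h']

/-- At the end of a phase the fixers have fixed their stars. -/
theorem exists_endAt_label (hi : i % 3 = 0)
    (hs : 𝓛.Sound (𝓖.graph i) σ (labelAt 𝓖 σ lab₀ i)) :
    ∃ lab : Fin n → 𝓛.labels, 𝓛.Sound (𝓖.graph i) σ lab ∧
      (∀ v ∈ 𝓖.nodes (i + 2), (endAt 𝓖 σ lab₀ (i + 2) v).1 = lab v) ∧
      (∀ v, v ∉ 𝓖.nodes (i + 2) → lab v = 𝓛.joinLabel v (σ v)) ∧
      (fixers 𝓖 σ lab₀ i = ∅ → lab = labelAt 𝓖 σ lab₀ i) ∧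
      ∀ x, ∀ y ∈ nbhd (𝓖.graph i) x, (𝓛.PairCorrect σ (labelAt 𝓖 σ lab₀ i) x y ∨
        x ∈ fixers 𝓖 σ lab₀ i ∨ y ∈ fixers 𝓖 σ lab₀ i) → 𝓛.PairCorrect σ lab x y := by
  obtain ⟨lab, hs', hfix, hnb, hother, hcor⟩ :=
    hs.exists_fix_finset (fixers 𝓖 σ lab₀ i) fun v hv w hw => fixers_far hv hw
  refine ⟨lab, hs', fun v hv => ?_, fun v hv => ?_, fun he => ?_, hcor⟩
  · have hlab : (beginAt 𝓖 σ lab₀ (i + 2) v).1 = labelAt 𝓖 σ lab₀ i v := by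
      rw [← labelAt_of_mem hv, labelAt_succ (by omega), labelAt_succ (by omega)]
    obtain ⟨h1, h2, h3⟩ := endAt_label_last (𝓖 := 𝓖) (σ := σ) (lab₀ := lab₀) (v := v)
      (i := i + 2) (by omega)
    rw [commit_iff hi] at h1 h2 h3
    simp only [announced_iff hi] at h2 h3
    by_cases hF : v ∈ fixers 𝓖 σ lab₀ i
    · obtain ⟨h0, hm, -⟩ := mem_fixers.1 hF
      obtain ⟨f, hf, -⟩ := plan_eq hi h0 hm
      rw [h1 hF, hfix v hF, hf]
      rfl
    · by_cases hw : ∃ w ∈ fixers 𝓖 σ lab₀ i, v ∈ nbhd (𝓖.graph i) w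
      · obtain ⟨w, hw, hvw⟩ := hw
        -- The announcement picked by choice may come from some other fixer `u`; `hnb` shows that
        -- any announcement leads to `lab v`.
        obtain ⟨u, hu, hvu, hL⟩ :=
          h2 hF ⟨lab v, w, hw, hvw, by rw [hlab]; exact hnb w hw v hvw⟩
        apply Subtype.ext
        rw [hL, hnb u hu v hvu, hlab]
      · rw [h3 hF (fun ⟨L', u, hu, hvu, _⟩ => hw ⟨u, hu, hvu⟩), hlab,
          hother v hF (fun w hw' hvw => hw ⟨w, hw', hvw⟩)]
  · have hv0 : v ∉ 𝓖.nodes i := fun h => hv (𝓖.nodes_mono (Nat.le_add_right i 2) h)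
    rw [hother v (fun h => hv0 (mem_fixers.1 h).1) (fun w _ hvw => hv0 (𝓖.mem_of_mem_nbhd hvw)),
      labelAt_of_notMem hv0]
  · funext v
    exact hother v (by simp [he]) (by simp [he])

theorem labelAt_phase (hc : 𝓛.InsertionClosed) (hi : i % 3 = 0) {lab : Fin n → 𝓛.labels}
    (h : ∀ v ∈ 𝓖.nodes (i + 2), (endAt 𝓖 σ lab₀ (i + 2) v).1 = lab v)
    (h' : ∀ v, v ∉ 𝓖.nodes (i + 2) → lab v = 𝓛.joinLabel v (σ v)) :
    labelAt 𝓖 σ lab₀ (i + 3) = fun v => 𝓛.prep v (σ v) (nbhd (𝓖.graph i) v)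
      (nbhd (𝓖.graph (i + 3)) v) (lab v) := by
  funext v
  by_cases hv : v ∈ 𝓖.nodes (i + 2)
  · rw [labelAt_of_mem (𝓖.nodes_subset _ hv), beginAt_phase_label hv (by omega), h v hv,
      (beginAt_last hi).1]
  · have hv0 : v ∉ 𝓖.nodes i := fun h => hv (𝓖.nodes_mono (Nat.le_add_right i 2) h)
    -- Such a node does not run `prep` at this phase start. Its old neighbourhood is empty, so by
    -- insertion closure a call would have changed nothing.
    rw [hc v (σ v) _ _ _ (not_mem_nbhd_self _ _) (not_mem_nbhd_self _ _)
      (by simp [𝓖.nbhd_eq_empty hv0]), h' v hv]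
    by_cases hv3 : v ∈ 𝓖.nodes (i + 3)
    · rw [labelAt_of_mem hv3, beginAt_join hv]
    · rw [labelAt_of_notMem hv3]

/-- No edge between old nodes is inserted or deleted at `v` before round `i + 1`. -/
def _root_.DynamicGraph.NoEvent (𝓖 : DynamicGraph n) (i : ℕ) (v : Fin n) : Prop :=
  nbhd (𝓖.graph i) v ⊆ nbhd (𝓖.graph (i + 1)) v ∧
    ∀ u ∈ 𝓖.nodes i, u ∈ nbhd (𝓖.graph (i + 1)) v → u ∈ nbhd (𝓖.graph i) v

theorem not_dirty_succ_iff : ¬ (beginAt 𝓖 σ lab₀ (i + 1) v).2.dirty ↔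
    v ∈ 𝓖.nodes i ∧ ¬ (endAt 𝓖 σ lab₀ i v).2.dirty ∧ 𝓖.NoEvent i v := by
  by_cases hv : v ∈ 𝓖.nodes i
  · rw [beginAt_succ_dirty hv]
    simp only [hv, true_and, not_or, Finset.not_nonempty_iff_eq_empty, DynamicGraph.NoEvent,
      Finset.sdiff_eq_empty_iff_subset]
    refine and_congr_right fun _ => and_comm.trans (and_congr_right fun _ => ?_)
    rw [Finset.eq_empty_iff_forall_notMem]
    simp only [Finset.mem_inter, Finset.mem_sdiff]
    exact ⟨fun h u hu hm => by_contra fun hn => h u ⟨⟨hm, hn⟩, hu⟩,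
      fun h u hu => hu.1.2 (h u hu.2 hu.1.1)⟩
  · simp [hv, beginAt_join_dirty hv]

theorem endAt_dirty_last (hi : i % 3 = 0) : (endAt 𝓖 σ lab₀ (i + 2) v).2.dirty ↔
    (beginAt 𝓖 σ lab₀ (i + 2) v).2.dirty ∧ v ∉ fixers 𝓖 σ lab₀ i := by
  rw [endAt_dirty, ← commit_iff hi]
  have : (i + 2) % 3 = 2 := by omega
  simp [this]

theorem endAt_dirty_of_ne (hi : i % 3 ≠ 2) :
    (endAt 𝓖 σ lab₀ i v).2.dirty ↔ (beginAt 𝓖 σ lab₀ i v).2.dirty := by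
  simp [endAt_dirty, hi]

theorem noEvent_of_nbhd_eq (h : nbhd (𝓖.graph (i + 1)) v = nbhd (𝓖.graph i) v) :
    𝓖.NoEvent i v := by
  unfold DynamicGraph.NoEvent
  rw [h]
  exact ⟨subset_rfl, fun _ _ h => h⟩

/-- Only a fix removes dirtiness, and a fixer has seen no change at its star up to the fix; so no
event during the phase can go unnoticed. -/
theorem clean_of_clean_phase (hi : i % 3 = 0) (h : ¬ (beginAt 𝓖 σ lab₀ (i + 3) v).2.dirty) :
    v ∈ 𝓖.nodes i ∧ (v ∈ fixers 𝓖 σ lab₀ i ∨ ¬ (beginAt 𝓖 σ lab₀ i v).2.dirty) ∧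
      𝓖.NoEvent i v ∧ 𝓖.NoEvent (i + 1) v ∧ 𝓖.NoEvent (i + 2) v := by
  obtain ⟨-, hd, h3⟩ := not_dirty_succ_iff.1 h
  rw [endAt_dirty_last hi] at hd
  by_cases hF : v ∈ fixers 𝓖 σ lab₀ i
  · obtain ⟨h0, hm, h2⟩ := mem_fixers.1 hF
    have h1 := (hm.2 v (Or.inl rfl)).1
    exact ⟨h0, Or.inl hF, noEvent_of_nbhd_eq h1, noEvent_of_nbhd_eq (h2.trans h1.symm), h3⟩
  · have hd' : ¬ (beginAt 𝓖 σ lab₀ (i + 2) v).2.dirty := fun h => hd ⟨h, hF⟩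
    obtain ⟨-, hd1, h2⟩ := not_dirty_succ_iff.1 hd'
    rw [endAt_dirty_of_ne (by omega)] at hd1
    obtain ⟨h0, hd0, h1⟩ := not_dirty_succ_iff.1 hd1
    rw [endAt_dirty_of_ne (by omega)] at hd0
    exact ⟨h0, Or.inr hd0, h1, h2, h3⟩

variable (𝓖 σ lab₀ i) in
/-- At the beginning of a phase the labeling is sound, and incorrect edges have a dirty endpoint. -/
structure PhaseInvariant : Prop where
  sound : 𝓛.Sound (𝓖.graph i) σ (labelAt 𝓖 σ lab₀ i)
  correct : ∀ x, ∀ y ∈ nbhd (𝓖.graph i) x, ¬ (beginAt 𝓖 σ lab₀ i x).2.dirty →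
    ¬ (beginAt 𝓖 σ lab₀ i y).2.dirty → 𝓛.PairCorrect σ (labelAt 𝓖 σ lab₀ i) x y

theorem phaseInvariant_zero (h : 𝓛.Legal (𝓖.nodes 0) (𝓖.graph 0) σ lab₀) :
    PhaseInvariant 𝓖 σ lab₀ 0 := by
  have hl : ∀ v ∈ 𝓖.nodes 0, labelAt 𝓖 σ lab₀ 0 v = lab₀ v := fun v hv => labelAt_of_mem hv
  have hcor : ∀ x, ∀ y ∈ nbhd (𝓖.graph 0) x, 𝓛.PairCorrect σ (labelAt 𝓖 σ lab₀ 0) x y := by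
    intro x y hxy
    have hx := 𝓖.mem_of_mem_nbhd (mem_nbhd_comm.1 hxy)
    unfold PairCorrect
    rw [hl x hx, hl y (𝓖.mem_of_mem_nbhd hxy)]
    exact (h x hx).2 y hxy
  refine ⟨⟨fun v => ?_, fun v u hu => 𝓛.edge_reciprocal _ _ _ _ _ _ _ _ (hcor v u hu)⟩,
    fun x y hxy _ _ => hcor x y hxy⟩
  by_cases hv : v ∈ 𝓖.nodes 0
  · rw [hl v hv]
    exact (h v hv).1
  · rw [labelAt_of_notMem hv, 𝓖.nbhd_eq_empty hv]
    exact 𝓛.prepared_joinLabel v (σ v)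

/-- An edge between nodes that are clean after the phase was there at its start: inserting it
between old nodes would have dirtied both, and a node inserted during the phase is still dirty.
Neighbourhoods of clean nodes only grow, so insertion closure keeps their labels, and correctness
after the fixes carries over. -/
theorem PhaseInvariant.next (hc : 𝓛.InsertionClosed) (hi : i % 3 = 0)
    (h : PhaseInvariant 𝓖 σ lab₀ i) : PhaseInvariant 𝓖 σ lab₀ (i + 3) := by
  obtain ⟨lab, hs, h1, h2, -, hcor⟩ := exists_endAt_label hi h.sound
  have hl := labelAt_phase hc hi h1 h2
  refine ⟨by rw [hl]; exact hs.prep, fun x y hxy hx hy => ?_⟩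
  obtain ⟨hx0, hxF, hx1, hx2, hx3⟩ := clean_of_clean_phase hi hx
  obtain ⟨hy0, hyF, hy1, hy2, hy3⟩ := clean_of_clean_phase hi hy
  have hkeep : ∀ z, 𝓖.NoEvent i z → 𝓖.NoEvent (i + 1) z → 𝓖.NoEvent (i + 2) z →
      labelAt 𝓖 σ lab₀ (i + 3) z = lab z := by
    intro z a b c
    rw [hl]
    exact hc z (σ z) _ _ _ (not_mem_nbhd_self _ _) (not_mem_nbhd_self _ _)
      ((a.1.trans b.1).trans c.1)
  have hm1 := 𝓖.nodes_subset i hy0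
  have hxy0 : y ∈ nbhd (𝓖.graph i) x :=
    hx1.2 y hy0 (hx2.2 y hm1 (hx3.2 y (𝓖.nodes_subset _ hm1) hxy))
  have := hcor x y hxy0 (by
    by_cases a : x ∈ fixers 𝓖 σ lab₀ i
    · tauto
    by_cases b : y ∈ fixers 𝓖 σ lab₀ i
    · tauto
    exact Or.inl (h.correct x y hxy0 (by tauto) (by tauto)))
  unfold PairCorrect
  rw [hkeep x hx1 hx2 hx3, hkeep y hy1 hy2 hy3]
  exact this

theorem phaseInvariant (hc : 𝓛.InsertionClosed)
    (h : 𝓛.Legal (𝓖.nodes 0) (𝓖.graph 0) σ lab₀) (p : ℕ) :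
    PhaseInvariant 𝓖 σ lab₀ (3 * p) := by
  induction p with
  | zero => exact phaseInvariant_zero h
  | succ p ih => exact ih.next hc (Nat.mul_mod_right 3 p)

end Phase

end LFL

/-! ### Amortized counting of bad phases. -/

namespace LFL

section Counting

variable {n : ℕ} {𝓛 : LFL n} {𝓖 : DynamicGraph n} {σ : Fin n → 𝓛.Input}
  {lab₀ : Fin n → 𝓛.labels} {i : ℕ} {v : Fin n}

variable (𝓖 σ lab₀ i) in
open Classical in
/-- The dirty nodes at the beginning of round `i`. -/
noncomputable def dirtyBegin : Finset (Fin n) :=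
  (𝓖.nodes i).filter fun v => (beginAt 𝓖 σ lab₀ i v).2.dirty

variable (𝓖 σ lab₀ i) in
open Classical in
/-- The dirty nodes at the end of round `i`. -/
noncomputable def dirtyEnd : Finset (Fin n) :=
  (𝓖.nodes i).filter fun v => (endAt 𝓖 σ lab₀ i v).2.dirty

theorem mem_dirtyBegin : v ∈ dirtyBegin 𝓖 σ lab₀ i ↔
    v ∈ 𝓖.nodes i ∧ (beginAt 𝓖 σ lab₀ i v).2.dirty := by simp [dirtyBegin]

theorem mem_dirtyEnd : v ∈ dirtyEnd 𝓖 σ lab₀ i ↔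
    v ∈ 𝓖.nodes i ∧ (endAt 𝓖 σ lab₀ i v).2.dirty := by simp [dirtyEnd]

theorem dirtyEnd_subset : dirtyEnd 𝓖 σ lab₀ i ⊆ dirtyBegin 𝓖 σ lab₀ i := fun v hv => by
  rw [mem_dirtyEnd, endAt_dirty] at hv
  exact mem_dirtyBegin.2 ⟨hv.1, hv.2.1⟩

theorem exists_edgeChange (hv : v ∈ 𝓖.nodes i) (h : ¬ 𝓖.NoEvent i v) :
    ∃ e ∈ 𝓖.edgeChanges i, v ∈ e := by
  have key : ∀ u ∈ 𝓖.nodes i, u ∈ symmDiff (nbhd (𝓖.graph i) v) (nbhd (𝓖.graph (i + 1)) v) →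
      ∃ e ∈ 𝓖.edgeChanges i, v ∈ e := by
    intro u hu hd
    refine ⟨s(v, u), ⟨?_, by simp [hv, hu]⟩, by simp⟩
    simpa [Set.mem_symmDiff, Finset.mem_symmDiff, mem_nbhd] using hd
  by_contra hn
  refine h ⟨fun u hu => ?_, fun u hu hu' => ?_⟩ <;> by_contra hc
  · exact hn (key u (𝓖.mem_of_mem_nbhd hu) (by simp [Finset.mem_symmDiff, hu, hc]))
  · exact hn (key u hu (by simp [Finset.mem_symmDiff, hu', hc]))

open Classical in
-- A node insertion dirties only the new node, an edge change at most its two endpoints.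
theorem card_dirtyBegin_succ : (dirtyBegin 𝓖 σ lab₀ (i + 1)).card + 2 * 𝓖.changes i ≤
    (dirtyEnd 𝓖 σ lab₀ i).card + 2 * 𝓖.changes (i + 1) := by
  have hsub : dirtyBegin 𝓖 σ lab₀ (i + 1) ⊆ dirtyEnd 𝓖 σ lab₀ i ∪
      ((𝓖.nodes (i + 1) \ 𝓖.nodes i) ∪
        (𝓖.edgeChanges i).toFinite.toFinset.biUnion Sym2.toFinset) := by
    intro v hv
    obtain ⟨hv1, hd⟩ := mem_dirtyBegin.1 hv
    simp only [Finset.mem_union, Finset.mem_sdiff, Finset.mem_biUnion, Set.Finite.mem_toFinset,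
      Sym2.mem_toFinset, mem_dirtyEnd]
    by_cases h0 : v ∈ 𝓖.nodes i
    · by_cases he : (endAt 𝓖 σ lab₀ i v).2.dirty
      · exact Or.inl ⟨h0, he⟩
      · exact Or.inr (Or.inr (exists_edgeChange h0 fun hn =>
          not_dirty_succ_iff.2 ⟨h0, he, hn⟩ hd))
    · exact Or.inr (Or.inl ⟨hv1, h0⟩)
  have h1 := Finset.card_le_card hsub
  have h2 := Finset.card_union_le (dirtyEnd 𝓖 σ lab₀ i) ((𝓖.nodes (i + 1) \ 𝓖.nodes i) ∪
    (𝓖.edgeChanges i).toFinite.toFinset.biUnion Sym2.toFinset)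
  have h3 := Finset.card_union_le (𝓖.nodes (i + 1) \ 𝓖.nodes i)
    ((𝓖.edgeChanges i).toFinite.toFinset.biUnion Sym2.toFinset)
  have h4 := Finset.card_biUnion_le_card_mul (𝓖.edgeChanges i).toFinite.toFinset
    Sym2.toFinset 2 (fun e _ => by rw [Sym2.card_toFinset]; split_ifs <;> omega)
  have h5 : 𝓖.changes (i + 1) = 𝓖.changes i +
      ((𝓖.nodes (i + 1) \ 𝓖.nodes i).card + (𝓖.edgeChanges i).ncard) := by
    unfold DynamicGraph.changes
    rw [Finset.sum_range_succ]
  rw [← Set.ncard_eq_toFinset_card] at h4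
  omega

theorem fixers_subset_dirtyBegin : fixers 𝓖 σ lab₀ i ⊆ dirtyBegin 𝓖 σ lab₀ i := fun v hv => by
  obtain ⟨h0, hm, -⟩ := mem_fixers.1 hv
  exact mem_dirtyBegin.2 ⟨h0, hm.1⟩

/-- In a static phase no node becomes dirty, and the smallest dirty node of the whole graph gets all
permissions and fixes its star. -/
theorem card_dirtyEnd_lt (hi : i % 3 = 0) (hch : 𝓖.changes (i + 2) = 𝓖.changes i)
    (hd : (dirtyBegin 𝓖 σ lab₀ i).Nonempty) :
    (dirtyEnd 𝓖 σ lab₀ (i + 2)).card < (dirtyBegin 𝓖 σ lab₀ i).card := by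
  have m1 : 𝓖.changes i ≤ 𝓖.changes (i + 1) := 𝓖.changes_mono (Nat.le_succ i)
  have m2 : 𝓖.changes (i + 1) ≤ 𝓖.changes (i + 2) := 𝓖.changes_mono (Nat.le_succ (i + 1))
  obtain ⟨hn1, hg1⟩ := 𝓖.eq_of_changes_eq (i := i) (by omega)
  obtain ⟨hn2, hg2⟩ := 𝓖.eq_of_changes_eq (i := i + 1)
    (show 𝓖.changes (i + 2) = 𝓖.changes (i + 1) by omega)
  obtain ⟨v, hv, hmin⟩ : ∃ v ∈ dirtyBegin 𝓖 σ lab₀ i, ∀ w ∈ dirtyBegin 𝓖 σ lab₀ i, v ≤ w :=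
    ⟨_, Finset.min'_mem _ hd, fun w hw => Finset.min'_le _ w hw⟩
  obtain ⟨hv0, hvd⟩ := mem_dirtyBegin.1 hv
  have hF : v ∈ fixers 𝓖 σ lab₀ i := by
    refine mem_fixers.2
      ⟨hv0, ⟨hvd, fun u hu => ⟨by rw [hg1], fun x hx hxd => ?_⟩⟩, by rw [hg2, hg1]⟩
    have hu0 : u ∈ 𝓖.nodes i := by
      rcases hu with rfl | hu
      · exact hv0
      · exact 𝓖.mem_of_mem_nbhd hu
    refine hmin x (mem_dirtyBegin.2 ⟨?_, hxd⟩)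
    rcases hx with rfl | hx
    · exact hu0
    · exact 𝓖.mem_of_mem_nbhd hx
  refine Finset.card_lt_card ((Finset.ssubset_iff_of_subset fun w hw => ?_).2 ⟨v, hv, fun h => ?_⟩)
  · obtain ⟨hw2, hwd⟩ := mem_dirtyEnd.1 hw
    have hw1 : w ∈ 𝓖.nodes (i + 1) := hn2 ▸ hw2
    have hw0 : w ∈ 𝓖.nodes i := hn1 ▸ hw1
    refine mem_dirtyBegin.2 ⟨hw0, by_contra fun hc => ?_⟩
    have hc1 := not_dirty_succ_iff.2
      ⟨hw0, (endAt_dirty_of_ne (by omega)).not.2 hc, noEvent_of_nbhd_eq (by rw [hg1])⟩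
    have hc2 := not_dirty_succ_iff.2
      ⟨hw1, (endAt_dirty_of_ne (by omega)).not.2 hc1, noEvent_of_nbhd_eq (by rw [hg2])⟩
    exact hc2 ((endAt_dirty_last hi).1 hwd).1
  · exact ((endAt_dirty_last hi).1 (mem_dirtyEnd.1 h).2).2 hF

theorem PhaseInvariant.legal (h : PhaseInvariant 𝓖 σ lab₀ i) (hd : dirtyBegin 𝓖 σ lab₀ i = ∅)
    {lab : Fin n → 𝓛.labels} (hl : ∀ v ∈ 𝓖.nodes i, lab v = labelAt 𝓖 σ lab₀ i v) :
    𝓛.Legal (𝓖.nodes i) (𝓖.graph i) σ lab := by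
  have hclean : ∀ v ∈ 𝓖.nodes i, ¬ (beginAt 𝓖 σ lab₀ i v).2.dirty := fun v hv hvd => by
    have := mem_dirtyBegin.2 ⟨hv, hvd⟩
    simp [hd] at this
  intro v hv
  refine ⟨by rw [hl v hv]; exact h.sound.prepared v, fun u hu => ?_⟩
  have hu0 := 𝓖.mem_of_mem_nbhd hu
  rw [hl v hv, hl u hu0]
  exact h.correct v u hu (hclean v hv) (hclean u hu0)

/-- Without dirty nodes the labeling is legal by the invariant and there are no fixers, so it stays
legal as long as the graph does not change. -/
theorem PhaseInvariant.not_incorrectRound (h : PhaseInvariant 𝓖 σ lab₀ i) (hi : i % 3 = 0)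
    (hd : dirtyBegin 𝓖 σ lab₀ i = ∅) {j : ℕ} (hj : j < 3)
    (hch : 𝓖.changes (i + j) = 𝓖.changes i) :
    ¬ 𝓛.phasedAlgorithm.IncorrectRound 𝓖 σ lab₀ (i + j) := by
  obtain ⟨hn, hg⟩ := 𝓖.eq_of_changes_eq_of_le (Nat.le_add_right i j) hch
  have hlab : labelAt 𝓖 σ lab₀ (i + j) = labelAt 𝓖 σ lab₀ i := by
    interval_cases j
    · rfl
    · exact labelAt_succ (by omega)
    · exact (labelAt_succ (by omega)).trans (labelAt_succ (by omega))
  have hbegin : ∀ v ∈ 𝓖.nodes i, (beginAt 𝓖 σ lab₀ (i + j) v).1 = labelAt 𝓖 σ lab₀ i v :=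
    fun v hv => by rw [← hlab, labelAt_of_mem (hn ▸ hv)]
  unfold FixingAlgorithm.IncorrectRound
  rw [hn, hg, not_or, not_not, not_not]
  refine ⟨h.legal hd hbegin, h.legal hd fun v hv => ?_⟩
  change (endAt 𝓖 σ lab₀ (i + j) v).1 = _
  by_cases hj2 : j = 2
  · subst hj2
    obtain ⟨lab, -, h1, -, h3, -⟩ := exists_endAt_label hi h.sound
    rw [h1 v (hn ▸ hv), h3 (Finset.subset_empty.1 (hd ▸ fixers_subset_dirtyBegin))]
  · rw [endAt_label (by omega), hbegin v hv]

variable (𝓖 σ lab₀) in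
/-- The phase contains a round with an inconsistent star or a topology change. -/
def BadPhase (p r : ℕ) : Prop :=
  (dirtyBegin 𝓖 σ lab₀ (3 * p)).Nonempty ∨ 𝓖.changes r ≠ 𝓖.changes (3 * p)

open Classical in
variable (𝓖 σ lab₀) in
/-- The bad phases among the first `p` ones. -/
noncomputable def badPhases (p : ℕ) : Finset ℕ :=
  (Finset.range p).filter fun q => BadPhase 𝓖 σ lab₀ q (3 * q + 2)

open Classical in
-- Potential argument with the number of dirty nodes as potential. Of the three units per change,
-- two cover the dirty nodes it creates and one covers the phase in which it occurs.
theorem card_badPhases (p : ℕ) : (badPhases 𝓖 σ lab₀ p).card +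
    (dirtyBegin 𝓖 σ lab₀ (3 * p)).card ≤ 3 * 𝓖.changes (3 * p) := by
  induction p with
  | zero => simp [badPhases, dirtyBegin, beginAt_zero]
  | succ p ih =>
    have hp : 3 * p % 3 = 0 := Nat.mul_mod_right 3 p
    have m1 : 𝓖.changes (3 * p) ≤ 𝓖.changes (3 * p + 1) := 𝓖.changes_mono (Nat.le_succ _)
    have m2 : 𝓖.changes (3 * p + 1) ≤ 𝓖.changes (3 * p + 2) := 𝓖.changes_mono (Nat.le_succ _)
    have m3 : 𝓖.changes (3 * p + 2) ≤ 𝓖.changes (3 * p + 3) := 𝓖.changes_mono (Nat.le_succ _)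
    have d1 := card_dirtyBegin_succ (𝓖 := 𝓖) (σ := σ) (lab₀ := lab₀) (i := 3 * p)
    have d2 := card_dirtyBegin_succ (𝓖 := 𝓖) (σ := σ) (lab₀ := lab₀) (i := 3 * p + 1)
    have d3 := card_dirtyBegin_succ (𝓖 := 𝓖) (σ := σ) (lab₀ := lab₀) (i := 3 * p + 2)
    have e0 := Finset.card_le_card (dirtyEnd_subset (𝓖 := 𝓖) (σ := σ) (lab₀ := lab₀) (i := 3 * p))
    have e1 := Finset.card_le_card
      (dirtyEnd_subset (𝓖 := 𝓖) (σ := σ) (lab₀ := lab₀) (i := 3 * p + 1))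
    have e2 := Finset.card_le_card
      (dirtyEnd_subset (𝓖 := 𝓖) (σ := σ) (lab₀ := lab₀) (i := 3 * p + 2))
    have e3 := card_dirtyEnd_lt (𝓖 := 𝓖) (σ := σ) (lab₀ := lab₀) hp
    change _ + (dirtyBegin 𝓖 σ lab₀ (3 * p + 3)).card ≤ 3 * 𝓖.changes (3 * p + 3)
    simp only [Nat.add_assoc, Nat.reduceAdd] at d1 d2 d3
    unfold badPhases at ih ⊢
    rw [Finset.range_add_one, Finset.filter_insert]
    split_ifs with hb
    · have := Finset.card_insert_le p
        ((Finset.range p).filter fun q => BadPhase 𝓖 σ lab₀ q (3 * q + 2))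
      -- A static bad phase is paid for by the dirty node that it removes, any other one by the
      -- spare unit of a change.
      by_cases hch : 𝓖.changes (3 * p + 2) = 𝓖.changes (3 * p)
      · have := e3 hch (by unfold BadPhase at hb; tauto)
        omega
      · omega
    · omega

open Classical in
theorem incorrect_le (hc : 𝓛.InsertionClosed)
    (h : 𝓛.Legal (𝓖.nodes 0) (𝓖.graph 0) σ lab₀) (i : ℕ) :
    𝓛.phasedAlgorithm.incorrect 𝓖 σ lab₀ i ≤ 9 * 𝓖.changes i := by
  set p := i / 3 with hp
  -- The phase containing round `i` may be incomplete, so only changes up to round `i` may make it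
  -- bad.
  set S : Finset ℕ := badPhases 𝓖 σ lab₀ p ∪ if BadPhase 𝓖 σ lab₀ p i then {p} else ∅ with hS
  have hcard : S.card ≤ 3 * 𝓖.changes i := by
    have h1 := card_badPhases (𝓖 := 𝓖) (σ := σ) (lab₀ := lab₀) p
    have h2 : 𝓖.changes (3 * p) ≤ 𝓖.changes i := 𝓖.changes_mono (by omega)
    refine (Finset.card_union_le _ _).trans ?_
    split_ifs with hb
    · rw [Finset.card_singleton]
      -- The current phase is paid for by a dirty node still counted in the potential, or by a
      -- change within the phase.
      rcases hb with hb | hb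
      · have := hb.card_pos
        omega
      · omega
    · rw [Finset.card_empty]
      omega
  have hsub : {r : ℕ | r ≤ i ∧ 𝓛.phasedAlgorithm.IncorrectRound 𝓖 σ lab₀ r} ⊆
      ↑(S.biUnion fun q => Finset.Ico (3 * q) (3 * q + 3)) := by
    rintro r ⟨hr, hinc⟩
    obtain ⟨j, hj, hrj⟩ : ∃ j < 3, r = 3 * (r / 3) + j := ⟨r % 3, by omega, by omega⟩
    rw [Finset.mem_coe, Finset.mem_biUnion]
    refine ⟨r / 3, ?_, Finset.mem_Ico.2 ⟨by omega, by omega⟩⟩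
    -- Used with `t = i` for the current phase and with the last round of the phase for the
    -- completed ones.
    have key : ∀ t, r ≤ t → BadPhase 𝓖 σ lab₀ (r / 3) t := by
      intro t ht
      by_contra hb
      unfold BadPhase at hb
      rw [not_or, not_not, Finset.not_nonempty_iff_eq_empty] at hb
      have m1 : 𝓖.changes (3 * (r / 3)) ≤ 𝓖.changes r := 𝓖.changes_mono (by omega)
      have m2 : 𝓖.changes r ≤ 𝓖.changes t := 𝓖.changes_mono ht
      refine (phaseInvariant hc h (r / 3)).not_incorrectRound (Nat.mul_mod_right 3 _) hb.1 hj ?_ ?_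
      · rw [← hrj]; omega
      · rw [← hrj]; exact hinc
    rw [hS, Finset.mem_union]
    by_cases hrp : r / 3 = p
    · right
      have := key i hr
      rw [hrp] at this ⊢
      simp [this]
    · left
      exact Finset.mem_filter.2 ⟨Finset.mem_range.2 (by omega), key _ (by omega)⟩
  have h1 := Set.ncard_le_ncard hsub (Finset.finite_toSet _)
  rw [Set.ncard_coe_finset] at h1
  have h2 := Finset.card_biUnion_le_card_mul S (fun q => Finset.Ico (3 * q) (3 * q + 3)) 3
    (fun q _ => by simp)
  unfold FixingAlgorithm.incorrect
  omega

theorem phasedAlgorithm_handlesInAmortizedRounds (hc : 𝓛.InsertionClosed) :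
    𝓛.phasedAlgorithm.HandlesInAmortizedRounds 9 := by
  intro 𝓖 σ lab₀ h i hpos
  rw [div_le_iff₀ (by exact_mod_cast hpos)]
  exact_mod_cast incorrect_le hc h i

end Counting

end LFL

theorem mainTheorem10 :
    ∃ k : ℕ, ∀ c : ℕ, ∃ C : ℕ, ∀ (n : ℕ) (𝓛 : LFL n),
      𝓛.BoundedBy c → 𝓛.InsertionClosed →
        ∃ A : FixingAlgorithm 𝓛,
          FitsInBits A.Msg (C * logUnit n) ∧ A.HandlesInAmortizedRounds k :=
  ⟨9, fun c => ⟨4 * c + 2, fun _ 𝓛 hb hc =>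
    ⟨𝓛.phasedAlgorithm, FixMessage.fitsInBits hb, LFL.phasedAlgorithm_handlesInAmortizedRounds hc⟩⟩⟩
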